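/- Let $\mathcal A$ be a unital algebra over $\mathbb C$ and let $\varphi,\varphi':\mathcal A\to\mathbb C$ be linear functionals with $\varphi(1_{\mathcal A})=1$ and $\varphi'(1_{\mathcal A})=0$. Let $\mathcal{NC}(n)$ and $\mathcal I(n)$ be the sets of non-crossing partitions and of interval partitions of $[n]=\{1,\dots,n\}$ (all blocks consist of consecutive integers; singletons are allowed). For families of functionals $f_m,f'_m:\mathcal A^m\to\mathbb C$ $(m\ge1)$ and a partition $\pi$ of $[n]$ put $$f_\pi(a_1,\dots,a_n)=\prod_{V\in\pi}f_{|V|}(a_V),\qquad \partial f_\pi(a_1,\dots,a_n)=\sum_{V\in\pi}f'_{|V|}(a_V)\prod_{W\in\pi,\,W\ne V}f_{|W|}(a_W),$$ where $a_V=(a_{v_1},\dots,a_{v_k})$ for $V=\{v_1<\dots<v_k\}$. The free cumulants $r_n$, Boolean cumulants $b_n$, infinitesimal free cumulants $r'_n$ and infinitesimal Boolean cumulants $b'_n$ are defined recursively by requiring, for all $n\ge1$ and $a_1,\dots,a_n\in\mathcal A$, $$\varphi(a_1\cdots a_n)=\sum_{\pi\in\mathcal{NC}(n)}r_\pi(a_1,\dots,a_n)=\sum_{\pi\in\mathcal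 I(n)}b_\pi(a_1,\dots,a_n),$$ $$\varphi'(a_1\cdots a_n)=\sum_{\pi\in\mathcal{NC}(n)}\partial r_\pi(a_1,\dots,a_n)=\sum_{\pi\in\mathcal I(n)}\partial b_\pi(a_1,\dots,a_n)$$ (products $a_1\cdots a_n$ taken in $\mathcal A$). Let $T_+(\mathcal A)=\bigoplus_{n>0}\mathcal A^{\otimes n}$, whose pure tensors are written as words $a_1\cdots a_n$, and let $H=T(T_+(\mathcal A))=\bigoplus_{n\ge0}T_+(\mathcal A)^{\otimes n}$, with unit $\mathbf 1$, product written $w_1|w_2$, and $H_+=\bigoplus_{n\ge1}T_+(\mathcal A)^{\otimes n}$. For $S=\{s_1<\dots<s_m\}\subseteq[n]$ let $a_S=a_{s_1}\cdots a_{s_m}$ (with $a_\emptyset=\mathbf 1$) and let $J_1,\dots,J_k$ be the interval components of $[n]\setminus S$ from left to right. Let $\Delta:H\to H\otimes H$ be the algebra morphism with $$\Delta(a_1\cdots a_n)=\sum_{S\subseteq[n]}a_S\otimes a_{J_1}|\cdots|a_{J_k},$$ let $\Delta_\prec$ and $\Delta_\succ$ be given on words by the same sum restricted to those $S$ with $1\in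 S$, respectively $1\notin S$, and extend them linearly to $H$ by $\Delta_\prec(w_1|w_2)=\Delta_\prec(w_1)\Delta(w_2)$ and $\Delta_\succ(w_1|w_2)=\Delta_\succ(w_1)\Delta(w_2)$ for $w_1\in T_+(\mathcal A)$, $w_2\in H$, and $\Delta_\prec(\mathbf 1)=\Delta_\succ(\mathbf 1)=0$. Let $\mathbb G=\{z+\hbar w: z,w\in\mathbb C\}$, $\hbar^2=0$. For $\mathbb C$-linear maps $\tilde f,\tilde g:H\to\mathbb G$ put $\tilde f\prec\tilde g=m_{\mathbb G}(\tilde f\otimes\tilde g)\Delta_\prec$ and $\tilde f\succ\tilde g=m_{\mathbb G}(\tilde f\otimes\tilde g)\Delta_\succ$, with $m_{\mathbb G}$ the product of $\mathbb G$. Let $\tilde\varepsilon:H\to\mathbb G$ be the linear map with $\tilde\varepsilon(\mathbf 1)=1$ that vanishes on $H_+$. A linear map $\tilde f:H\to\mathbb G$ is an infinitesimal character if $\tilde f(\mathbf 1)=0$ and $\tilde f(w_1|w_2)=0$ for all $w_1,w_2\in H_+$. Let $\tilde\Phi=\Phi+\hbar\Phi':H\to\mathbb G$ be the unital algebra morphism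 with $\Phi(a_1\cdots a_n)=\varphi(a_1\cdot_{\mathcal A}\cdots\cdot_{\mathcal A}a_n)$ and $\Phi'(a_1\cdots a_n)=\varphi'(a_1\cdot_{\mathcal A}\cdots\cdot_{\mathcal A}a_n)$ on words. Then there are a unique infinitesimal character $\tilde\kappa=\kappa+\hbar\kappa'$ and a unique infinitesimal character $\tilde\beta=\beta+\hbar\beta'$ with $$\tilde\Phi=\tilde\varepsilon+\tilde\kappa\prec\tilde\Phi,\qquad \tilde\Phi=\tilde\varepsilon+\tilde\Phi\succ\tilde\beta,$$ and for every $n\ge1$ and every word $w=a_1\cdots a_n$ with $a_1,\dots,a_n\in\mathcal A$, $$\kappa'(w)=r'_n(a_1,\dots,a_n)\qquad\text{and}\qquad \beta'(w)=b'_n(a_1,\dots,a_n).$$ -/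

import Mathlib

open scoped TensorProduct DirectSum

noncomputable section

namespace InfShuffle

/-! ### Partitions of `[n]` (indexed as `Fin n`) -/

/-- `π` is non-crossing: if `i < j < k < l` with `i, k` in a block `V` and `j, l` in a block `W`,
then `V = W`. -/
def NonCrossing {n : ℕ} (π : Finpartition (Finset.univ : Finset (Fin n))) : Prop :=
  ∀ V ∈ π.parts, ∀ W ∈ π.parts, ∀ i j k l : Fin n,
    i < j → j < k → k < l → i ∈ V → k ∈ V → j ∈ W → l ∈ W → V = W

/-- `π` is an interval partition: every block consists of consecutive elements. -/
def IsIntervalPartition {n : ℕ} (π : Finpartition (Finset.univ : Finset (Fin n))) : Prop :=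
  ∀ V ∈ π.parts, ∀ i ∈ V, ∀ k ∈ V, ∀ j : Fin n, i ≤ j → j ≤ k → j ∈ V

open Classical in
/-- `NC(n)`. -/
def NC (n : ℕ) : Finset (Finpartition (Finset.univ : Finset (Fin n))) :=
  Finset.univ.filter NonCrossing

open Classical in
/-- `I(n)`. -/
def IntervalPartitions (n : ℕ) : Finset (Finpartition (Finset.univ : Finset (Fin n))) :=
  Finset.univ.filter IsIntervalPartition

/-! ### Multivariate moments and cumulants -/

section Cumulants

variable {A : Type*}

/-- The tuple `a_S = (a_{s_1}, …, a_{s_m})` for `S = {s_1 < ⋯ < s_m} ⊆ [n]`. -/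
def restrict {n : ℕ} (a : Fin n → A) (S : Finset (Fin n)) : Fin S.card → A :=
  fun i => a (S.orderEmbOfFin rfl i)

/-- `f_π(a_1, …, a_n) = ∏_{V ∈ π} f_{|V|}(a_V)`. -/
def blockProd (f : ∀ n : ℕ, (Fin n → A) → ℂ) {n : ℕ}
    (π : Finpartition (Finset.univ : Finset (Fin n))) (a : Fin n → A) : ℂ :=
  ∏ V ∈ π.parts, f V.card (restrict a V)

/-- `∂f_π(a_1, …, a_n) = ∑_{V ∈ π} f'_{|V|}(a_V) ∏_{W ∈ π, W ≠ V} f_{|W|}(a_W)`. -/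
def blockDeriv (f f' : ∀ n : ℕ, (Fin n → A) → ℂ) {n : ℕ}
    (π : Finpartition (Finset.univ : Finset (Fin n))) (a : Fin n → A) : ℂ :=
  ∑ V ∈ π.parts, f' V.card (restrict a V) *
    ∏ W ∈ π.parts.erase V, f W.card (restrict a W)

/-- The multivariate moments `φ_n(a_1, …, a_n) = φ(a_1 ⋯ a_n)`. -/
def moment [Ring A] [Algebra ℂ A] (φ : A →ₗ[ℂ] ℂ) (n : ℕ) (a : Fin n → A) : ℂ :=
  φ (List.ofFn a).prod

theorem card_lt_of_mem_parts {n : ℕ} {π : Finpartition (Finset.univ : Finset (Fin n))}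
    (hπ : π.parts ≠ {Finset.univ}) {V : Finset (Fin n)} (hV : V ∈ π.parts) : V.card < n := by
  have h1 : V ≠ Finset.univ := by
    rintro rfl
    apply hπ
    ext W
    rw [Finset.mem_singleton]
    constructor
    · intro hW
      by_contra hne
      have hd : Disjoint W Finset.univ := π.disjoint hW hV hne
      have : W = ⊥ := by
        rw [Finset.disjoint_left] at hd
        exact Finset.eq_empty_of_forall_notMem fun x hx => hd hx (Finset.mem_univ x)
      exact π.bot_notMem (this ▸ hW)
    · rintro rfl
      exact hV
  simpa using Finset.card_lt_univ_of_notMem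
    (Classical.choose_spec (not_forall.mp (mt Finset.eq_univ_iff_forall.mpr h1)))

open Classical in
/-- The cumulants attached to a class `P` of partitions, obtained by solving the triangular system
`m_n(a) = ∑_{π ∈ P(n)} c_π(a)` for its top term `c_n(a)`, the term of the one-block partition. -/
def cumulant (P : ∀ n : ℕ, Finset (Finpartition (Finset.univ : Finset (Fin n))))
    (m : ∀ n : ℕ, (Fin n → A) → ℂ) : ∀ n : ℕ, (Fin n → A) → ℂ
  | n, a => m n a -
      ∑ π : {π // π ∈ P n ∧ π.parts ≠ {Finset.univ}},
        ∏ V : {V // V ∈ π.1.parts}, cumulant P m V.1.card (restrict a V.1)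
termination_by n => n
decreasing_by exact card_lt_of_mem_parts π.2.2 V.2

open Classical in
/-- The infinitesimal cumulants attached to a class `P` of partitions, obtained by solving
`m'_n(a) = ∑_{π ∈ P(n)} ∂c_π(a)` for its top term `c'_n(a)`, with `c` the cumulants of `m`. -/
def infCumulant (P : ∀ n : ℕ, Finset (Finpartition (Finset.univ : Finset (Fin n))))
    (m m' : ∀ n : ℕ, (Fin n → A) → ℂ) : ∀ n : ℕ, (Fin n → A) → ℂ
  | n, a => m' n a -
      ∑ π : {π // π ∈ P n ∧ π.parts ≠ {Finset.univ}},
        ∑ V : {V // V ∈ π.1.parts}, infCumulant P m m' V.1.card (restrict a V.1) *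
          ∏ W ∈ π.1.parts.erase V.1, cumulant P m W.card (restrict a W)
termination_by n => n
decreasing_by exact card_lt_of_mem_parts π.2.2 V.2

theorem restrict_univ (f : ∀ n : ℕ, (Fin n → A) → ℂ) {n : ℕ} (a : Fin n → A) :
    f (Finset.univ : Finset (Fin n)).card (restrict a Finset.univ) = f n a := by
  have key : ∀ (k : ℕ) (hk : (Finset.univ : Finset (Fin n)).card = k),
      f (Finset.univ : Finset (Fin n)).card (restrict a Finset.univ) =
        f k (fun i => a (Finset.univ.orderEmbOfFin hk i)) := by
    rintro k rfl
    rfl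
  rw [key n (by simp)]
  congr 1
  funext i
  have h := Finset.orderEmbOfFin_unique' (s := (Finset.univ : Finset (Fin n))) (by simp)
    (f := RelEmbedding.refl (· ≤ ·)) (fun x => Finset.mem_univ x)
  rw [← h]
  rfl

open Classical in
theorem sum_split {n : ℕ} {P : Finset (Finpartition (Finset.univ : Finset (Fin n)))}
    {τ : Finpartition (Finset.univ : Finset (Fin n))} (hτ : τ.parts = {Finset.univ})
    (hP : τ ∈ P) (F : Finpartition (Finset.univ : Finset (Fin n)) → ℂ) :
    ∑ π ∈ P, F π = F τ + ∑ π : {π // π ∈ P ∧ π.parts ≠ {Finset.univ}}, F π.1 := by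
  rw [← Finset.add_sum_erase P F hP]
  congr 1
  refine Finset.sum_subtype (P.erase τ) (fun π => ?_) F
  rw [Finset.mem_erase, and_comm]
  refine and_congr_right fun _ => not_congr ⟨fun h => h ▸ hτ, fun h => ?_⟩
  exact Finpartition.ext (h.trans hτ.symm)

/-- The moment-cumulant formula `m_n = ∑_{π ∈ P(n)} c_π`. -/
theorem sum_blockProd_cumulant
    (P : ∀ n : ℕ, Finset (Finpartition (Finset.univ : Finset (Fin n))))
    (m : ∀ n : ℕ, (Fin n → A) → ℂ) {n : ℕ} {τ : Finpartition (Finset.univ : Finset (Fin n))}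
    (hτ : τ.parts = {Finset.univ}) (hP : τ ∈ P n) (a : Fin n → A) :
    m n a = ∑ π ∈ P n, blockProd (cumulant P m) π a := by
  classical
  rw [sum_split hτ hP]
  have h1 : blockProd (cumulant P m) τ a = cumulant P m n a := by
    rw [blockProd, hτ, Finset.prod_singleton, restrict_univ (cumulant P m)]
  rw [h1, cumulant]
  have h2 : ∀ π : Finpartition (Finset.univ : Finset (Fin n)),
      blockProd (cumulant P m) π a =
        ∏ V : {V // V ∈ π.parts}, cumulant P m V.1.card (restrict a V.1) := fun π =>
    (Finset.prod_coe_sort π.parts fun V => cumulant P m V.card (restrict a V)).symm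
  simp only [h2]
  ring

/-- The infinitesimal moment-cumulant formula `m'_n = ∑_{π ∈ P(n)} ∂c_π`. -/
theorem sum_blockDeriv_infCumulant
    (P : ∀ n : ℕ, Finset (Finpartition (Finset.univ : Finset (Fin n))))
    (m m' : ∀ n : ℕ, (Fin n → A) → ℂ) {n : ℕ}
    {τ : Finpartition (Finset.univ : Finset (Fin n))}
    (hτ : τ.parts = {Finset.univ}) (hP : τ ∈ P n) (a : Fin n → A) :
    m' n a = ∑ π ∈ P n, blockDeriv (cumulant P m) (infCumulant P m m') π a := by
  classical
  rw [sum_split hτ hP]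
  have h1 : blockDeriv (cumulant P m) (infCumulant P m m') τ a = infCumulant P m m' n a := by
    rw [blockDeriv, hτ, Finset.sum_singleton, restrict_univ (infCumulant P m m')]
    simp
  rw [h1, infCumulant]
  have h2 : ∀ π : Finpartition (Finset.univ : Finset (Fin n)),
      blockDeriv (cumulant P m) (infCumulant P m m') π a =
        ∑ V : {V // V ∈ π.parts}, infCumulant P m m' V.1.card (restrict a V.1) *
          ∏ W ∈ π.parts.erase V.1, cumulant P m W.card (restrict a W) := fun π => by
    rw [blockDeriv, ← Finset.sum_coe_sort π.parts]
  simp only [h2]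
  ring

theorem exists_one_block {n : ℕ} (hn : 0 < n) :
    ∃ τ : Finpartition (Finset.univ : Finset (Fin n)),
      τ.parts = {Finset.univ} ∧ τ ∈ NC n ∧ τ ∈ IntervalPartitions n := by
  classical
  have hne : (Finset.univ : Finset (Fin n)) ≠ ⊥ :=
    Finset.nonempty_iff_ne_empty.mp ⟨⟨0, hn⟩, Finset.mem_univ _⟩
  refine ⟨Finpartition.indiscrete hne, rfl, ?_, ?_⟩
  · refine Finset.mem_filter.mpr ⟨Finset.mem_univ _, fun V hV W hW _ _ _ _ _ _ _ _ _ _ _ => ?_⟩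
    exact (Finset.mem_singleton.mp hV).trans (Finset.mem_singleton.mp hW).symm
  · refine Finset.mem_filter.mpr ⟨Finset.mem_univ _, fun V hV _ _ _ _ _ _ _ => ?_⟩
    rw [Finset.mem_singleton.mp hV]
    exact Finset.mem_univ _

theorem restrict_update_of_notMem {n : ℕ} (a : Fin n → A) {S : Finset (Fin n)} {i : Fin n}
    (hi : i ∉ S) (x : A) : restrict (Function.update a i x) S = restrict a S := by
  funext k
  refine Function.update_of_ne ?_ _ _
  rintro rfl
  exact hi (Finset.orderEmbOfFin_mem S rfl k)

theorem restrict_update_of_mem {n : ℕ} (a : Fin n → A) {S : Finset (Fin n)} {i : Fin n}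
    (hi : i ∈ S) : ∃ k, ∀ x, restrict (Function.update a i x) S =
      Function.update (restrict a S) k x := by
  have : i ∈ Set.range (S.orderEmbOfFin rfl) := by
    rw [Finset.range_orderEmbOfFin]
    exact hi
  obtain ⟨k, rfl⟩ := this
  exact ⟨k, fun x => Function.update_comp_eq_of_injective a (S.orderEmbOfFin rfl).injective k x⟩

variable [Ring A] [Algebra ℂ A]

/-- The free cumulants `r_n`. -/
def freeCumulant (φ : A →ₗ[ℂ] ℂ) : ∀ n : ℕ, (Fin n → A) → ℂ :=
  cumulant NC (moment φ)

/-- The Boolean cumulants `b_n`. -/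
def booleanCumulant (φ : A →ₗ[ℂ] ℂ) : ∀ n : ℕ, (Fin n → A) → ℂ :=
  cumulant IntervalPartitions (moment φ)

/-- The infinitesimal free cumulants `r'_n`. -/
def infFreeCumulant (φ φ' : A →ₗ[ℂ] ℂ) : ∀ n : ℕ, (Fin n → A) → ℂ :=
  infCumulant NC (moment φ) (moment φ')

/-- The infinitesimal Boolean cumulants `b'_n`. -/
def infBooleanCumulant (φ φ' : A →ₗ[ℂ] ℂ) : ∀ n : ℕ, (Fin n → A) → ℂ :=
  infCumulant IntervalPartitions (moment φ) (moment φ')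

theorem free_moment_cumulant (φ : A →ₗ[ℂ] ℂ) {n : ℕ} (hn : 0 < n) (a : Fin n → A) :
    φ (List.ofFn a).prod = ∑ π ∈ NC n, blockProd (freeCumulant φ) π a :=
  let ⟨_, h, h1, _⟩ := exists_one_block hn
  sum_blockProd_cumulant NC (moment φ) h h1 a

theorem boolean_moment_cumulant (φ : A →ₗ[ℂ] ℂ) {n : ℕ} (hn : 0 < n) (a : Fin n → A) :
    φ (List.ofFn a).prod = ∑ π ∈ IntervalPartitions n, blockProd (booleanCumulant φ) π a :=
  let ⟨_, h, _, h2⟩ := exists_one_block hn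
  sum_blockProd_cumulant IntervalPartitions (moment φ) h h2 a

theorem inf_free_moment_cumulant (φ φ' : A →ₗ[ℂ] ℂ) {n : ℕ} (hn : 0 < n) (a : Fin n → A) :
    φ' (List.ofFn a).prod =
      ∑ π ∈ NC n, blockDeriv (freeCumulant φ) (infFreeCumulant φ φ') π a :=
  let ⟨_, h, h1, _⟩ := exists_one_block hn
  sum_blockDeriv_infCumulant NC (moment φ) (moment φ') h h1 a

theorem inf_boolean_moment_cumulant (φ φ' : A →ₗ[ℂ] ℂ) {n : ℕ} (hn : 0 < n) (a : Fin n → A) :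
    φ' (List.ofFn a).prod =
      ∑ π ∈ IntervalPartitions n,
        blockDeriv (booleanCumulant φ) (infBooleanCumulant φ φ') π a :=
  let ⟨_, h, _, h2⟩ := exists_one_block hn
  sum_blockDeriv_infCumulant IntervalPartitions (moment φ) (moment φ') h h2 a

end Cumulants

/-! ### The double tensor algebra and its coproducts -/

section Hopf

variable (A : Type*) [Ring A] [Algebra ℂ A]

/-- `T_+(A) = ⨁_{n > 0} A^{⊗ n}`. -/
abbrev TPlus : Type _ := ⨁ n : ℕ+, ⨂[ℂ]^(n : ℕ) A

/-- `H = T(T_+(A))`; its product is the bar product. -/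
abbrev DoubleTensor : Type _ := TensorAlgebra ℂ (TPlus A)

variable {A}

/-- The word `a_1 ⋯ a_n ∈ T_+(A)`, as a multilinear function of its letters. -/
def wordPlus (n : ℕ+) : MultilinearMap ℂ (fun _ : Fin (n : ℕ) => A) (TPlus A) :=
  (DirectSum.lof ℂ ℕ+ (fun n : ℕ+ => ⨂[ℂ]^(n : ℕ) A) n).compMultilinearMap
    (PiTensorProduct.tprod ℂ)

/-- The word `a_1 ⋯ a_n`, as an element of `H`. -/
def word (n : ℕ+) : MultilinearMap ℂ (fun _ : Fin (n : ℕ) => A) (DoubleTensor A) :=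
  (TensorAlgebra.ι ℂ).compMultilinearMap (wordPlus n)

/-- The word `a_S` in `H`; it is the unit if `S` is empty. -/
def subword {n : ℕ} (a : Fin n → A) (S : Finset (Fin n)) : DoubleTensor A :=
  if h : 0 < S.card then word ⟨S.card, h⟩ (restrict a S) else 1

/-- The interval component of `U ⊆ [n]` that contains `i` (empty if `i ∉ U`). -/
def component {n : ℕ} (U : Finset (Fin n)) (i : Fin n) : Finset (Fin n) :=
  Finset.univ.filter fun j => Finset.uIcc i j ⊆ U

/-- The interval components `J_1, …, J_k` of `U ⊆ [n]`, listed from left to right: each component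
is listed at its least element. -/
def components {n : ℕ} (U : Finset (Fin n)) : List (Finset (Fin n)) :=
  ((U.filter fun i => ∀ j ∈ component U i, i ≤ j).sort (· ≤ ·)).map (component U)

/-- `a_{J_1} | ⋯ | a_{J_k}` for a list `J_1, …, J_k` of subsets of `[n]`. -/
def barWord {n : ℕ} (a : Fin n → A) (L : List (Finset (Fin n))) : DoubleTensor A :=
  (L.map (subword a)).prod

theorem subword_update_of_notMem {n : ℕ} (a : Fin n → A) {S : Finset (Fin n)} {i : Fin n}
    (hi : i ∉ S) (x : A) : subword (Function.update a i x) S = subword a S := by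
  rw [subword, subword, restrict_update_of_notMem a hi]

theorem subword_update_of_mem {n : ℕ} (a : Fin n → A) {S : Finset (Fin n)} {i : Fin n}
    (hi : i ∈ S) : ∃ f : A →ₗ[ℂ] DoubleTensor A, ∀ x, subword (Function.update a i x) S = f x := by
  obtain ⟨k, hk⟩ := restrict_update_of_mem a hi
  have h : 0 < S.card := Finset.card_pos.mpr ⟨i, hi⟩
  refine ⟨(word ⟨S.card, h⟩).toLinearMap (restrict a S) k, fun x => ?_⟩
  rw [subword, dif_pos h, hk]
  rfl

theorem barWord_update_of_notMem {n : ℕ} (a : Fin n → A) {L : List (Finset (Fin n))} {i : Fin n}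
    (hi : ∀ V ∈ L, i ∉ V) (x : A) : barWord (Function.update a i x) L = barWord a L := by
  rw [barWord, barWord, List.map_congr_left fun V hV => subword_update_of_notMem a (hi V hV) x]

theorem barWord_update_of_mem {n : ℕ} (a : Fin n → A) {i : Fin n} :
    ∀ {L : List (Finset (Fin n))}, L.Pairwise Disjoint → (∃ V ∈ L, i ∈ V) →
      ∃ f : A →ₗ[ℂ] DoubleTensor A, ∀ x, barWord (Function.update a i x) L = f x
  | [], _, h => by simp at h
  | V :: L, hL, h => by
    rw [List.pairwise_cons] at hL
    by_cases hV : i ∈ V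
    · have hn : ∀ W ∈ L, i ∉ W := fun W hW => Finset.disjoint_left.mp (hL.1 W hW) hV
      obtain ⟨f, hf⟩ := subword_update_of_mem a hV
      refine ⟨(LinearMap.mulRight ℂ (barWord a L)).comp f, fun x => ?_⟩
      have := barWord_update_of_notMem a hn x
      rw [barWord] at this
      rw [barWord, List.map_cons, List.prod_cons, hf, this]
      rfl
    · have h' : ∃ W ∈ L, i ∈ W := by
        obtain ⟨W, hW, hi⟩ := h
        rcases List.mem_cons.mp hW with rfl | hW
        · exact absurd hi hV
        · exact ⟨W, hW, hi⟩
      obtain ⟨f, hf⟩ := barWord_update_of_mem a hL.2 h'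
      refine ⟨(LinearMap.mulLeft ℂ (subword a V)).comp f, fun x => ?_⟩
      have := hf x
      rw [barWord] at this
      rw [barWord, List.map_cons, List.prod_cons, this, subword_update_of_notMem a hV]
      rfl

theorem mem_component {n : ℕ} {U : Finset (Fin n)} {i j : Fin n} :
    j ∈ component U i ↔ ∀ k, (i ≤ k ∧ k ≤ j) ∨ (j ≤ k ∧ k ≤ i) → k ∈ U := by
  rw [component, Finset.mem_filter, and_iff_right (Finset.mem_univ j), Finset.subset_iff]
  refine forall_congr' fun k => imp_congr_left ?_
  rw [Finset.mem_uIcc', ← Set.mem_uIcc, Set.mem_uIcc]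

theorem component_eq {n : ℕ} {U : Finset (Fin n)} {i j : Fin n} (h : j ∈ component U i) :
    component U j = component U i := by
  ext k
  rw [mem_component] at *
  rw [mem_component]
  constructor
  · intro h' l hl
    by_cases h1 : (i ≤ l ∧ l ≤ j) ∨ (j ≤ l ∧ l ≤ i)
    · exact h l h1
    · exact h' l (by omega)
  · intro h' l hl
    by_cases h1 : (i ≤ l ∧ l ≤ j) ∨ (j ≤ l ∧ l ≤ i)
    · exact h l h1
    · exact h' l (by omega)

theorem self_mem_component {n : ℕ} {U : Finset (Fin n)} {i : Fin n} (h : i ∈ U) :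
    i ∈ component U i := by
  rw [mem_component]
  intro k hk
  have : k = i := by omega
  exact this ▸ h

theorem component_subset {n : ℕ} {U : Finset (Fin n)} {i j : Fin n} (h : j ∈ component U i) :
    j ∈ U :=
  mem_component.mp h j (by omega)

theorem components_pairwise {n : ℕ} (U : Finset (Fin n)) :
    (components U).Pairwise Disjoint := by
  rw [components, List.pairwise_map]
  refine List.Pairwise.imp_of_mem ?_ (Finset.sort_nodup _ _)
  intro i j hi hj hne
  rw [Finset.mem_sort, Finset.mem_filter] at hi hj
  rw [Finset.disjoint_left]
  intro k hki hkj
  have h : component U i = component U j := (component_eq hki).symm.trans (component_eq hkj)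
  exact hne (le_antisymm (hi.2 j (h ▸ self_mem_component hj.1))
    (hj.2 i (h ▸ self_mem_component hi.1)))

theorem exists_mem_components {n : ℕ} {U : Finset (Fin n)} {i : Fin n} :
    (∃ V ∈ components U, i ∈ V) ↔ i ∈ U := by
  constructor
  · rintro ⟨V, hV, hi⟩
    rw [components, List.mem_map] at hV
    obtain ⟨j, -, rfl⟩ := hV
    exact component_subset hi
  · intro hi
    have hne : (component U i).Nonempty := ⟨i, self_mem_component hi⟩
    have hm := Finset.min'_mem _ hne
    have he := component_eq hm
    refine ⟨component U i, ?_, self_mem_component hi⟩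
    rw [components, List.mem_map]
    refine ⟨(component U i).min' hne, ?_, he⟩
    rw [Finset.mem_sort, Finset.mem_filter]
    refine ⟨component_subset hm, fun j hj => ?_⟩
    rw [he] at hj
    exact Finset.min'_le _ _ hj

theorem cut_update {n : ℕ} (S : Finset (Fin n)) (a : Fin n → A) (i : Fin n) :
    ∃ f : A →ₗ[ℂ] DoubleTensor A ⊗[ℂ] DoubleTensor A, ∀ x,
      subword (Function.update a i x) S ⊗ₜ[ℂ]
        barWord (Function.update a i x) (components Sᶜ) = f x := by
  by_cases hi : i ∈ S
  · obtain ⟨f, hf⟩ := subword_update_of_mem a hi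
    refine ⟨((TensorProduct.mk ℂ _ _).flip (barWord a (components Sᶜ))).comp f, fun x => ?_⟩
    rw [hf, barWord_update_of_notMem]
    · rfl
    · intro V hV hiV
      exact Finset.mem_compl.mp (exists_mem_components.mp ⟨V, hV, hiV⟩) hi
  · obtain ⟨f, hf⟩ := barWord_update_of_mem a (components_pairwise Sᶜ)
      (exists_mem_components.mpr (Finset.mem_compl.mpr hi))
    refine ⟨(TensorProduct.mk ℂ _ _ (subword a S)).comp f, fun x => ?_⟩
    rw [hf, subword_update_of_notMem a hi]
    rfl

/-- `(a_1, …, a_n) ↦ a_S ⊗ a_{J_1} | ⋯ | a_{J_k}`, with `J_1, …, J_k` the interval components of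
`[n] \ S`. -/
def cut {n : ℕ} (S : Finset (Fin n)) :
    MultilinearMap ℂ (fun _ : Fin n => A) (DoubleTensor A ⊗[ℂ] DoubleTensor A) where
  toFun a := subword a S ⊗ₜ[ℂ] barWord a (components Sᶜ)
  map_update_add' {inst} a i x y := by
    rw [Subsingleton.elim inst (instDecidableEqFin n)]
    obtain ⟨f, hf⟩ := cut_update S a i
    rw [hf, hf, hf, map_add]
  map_update_smul' {inst} a i c x := by
    rw [Subsingleton.elim inst (instDecidableEqFin n)]
    obtain ⟨f, hf⟩ := cut_update S a i
    rw [hf, hf, map_smul]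

/-- The linear map `a_1 ⋯ a_n ↦ ∑_{S ∈ 𝒮(n)} a_S ⊗ a_{J_1} | ⋯ | a_{J_k}` on `T_+(A)`. -/
def cutSum (𝒮 : ∀ n : ℕ+, Finset (Finset (Fin (n : ℕ)))) :
    TPlus A →ₗ[ℂ] DoubleTensor A ⊗[ℂ] DoubleTensor A :=
  DirectSum.toModule ℂ ℕ+ _ fun n => PiTensorProduct.lift (∑ S ∈ 𝒮 n, cut S)

variable (A)

/-- The coproduct `Δ` of `H`, a morphism of algebras. -/
def coproduct : DoubleTensor A →ₐ[ℂ] DoubleTensor A ⊗[ℂ] DoubleTensor A :=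
  TensorAlgebra.lift ℂ (cutSum fun _ => Finset.univ)

/-- `Δ_≺` on words: the sum over the subsets `S` that contain the first letter. -/
def leftHalf : TPlus A →ₗ[ℂ] DoubleTensor A ⊗[ℂ] DoubleTensor A :=
  cutSum fun n => Finset.univ.filter fun S => (⟨0, n.pos⟩ : Fin (n : ℕ)) ∈ S

/-- `Δ_≻` on words: the sum over the subsets `S` that do not contain the first letter. -/
def rightHalf : TPlus A →ₗ[ℂ] DoubleTensor A ⊗[ℂ] DoubleTensor A :=
  cutSum fun n => Finset.univ.filter fun S => (⟨0, n.pos⟩ : Fin (n : ℕ)) ∉ S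

variable {A}

/-- The extension of `d : T_+(A) → H ⊗ H` to the linear map `D : H → H ⊗ H` with `D(𝟏) = 0` and
`D(w_1 | w_2) = d(w_1) Δ(w_2)` for `w_1 ∈ T_+(A)` and `w_2 ∈ H`; see `extend_one` and
`extend_mul`. It is built from the action of `H` on pairs in which `w_1 ∈ T_+(A)` acts by
`(u, v) ↦ (d(w_1) v, Δ(w_1) v)`: then `w` sends `(0, 1)` to `(D(w), Δ(w))`. -/
def extend (d : TPlus A →ₗ[ℂ] DoubleTensor A ⊗[ℂ] DoubleTensor A) :
    DoubleTensor A →ₗ[ℂ] DoubleTensor A ⊗[ℂ] DoubleTensor A :=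
  let M := DoubleTensor A ⊗[ℂ] DoubleTensor A
  let act : TPlus A →ₗ[ℂ] Module.End ℂ (M × M) :=
    { toFun := fun x => ((LinearMap.mulLeft ℂ (d x)).prod
        (LinearMap.mulLeft ℂ (coproduct A (TensorAlgebra.ι ℂ x)))).comp (LinearMap.snd ℂ M M)
      map_add' := fun x y => by ext <;> simp [add_mul]
      map_smul' := fun c x => by ext <;> simp }
  LinearMap.fst ℂ M M ∘ₗ LinearMap.applyₗ ((0, 1) : M × M) ∘ₗ
    (TensorAlgebra.lift ℂ act).toLinearMap

theorem extend_one (d : TPlus A →ₗ[ℂ] DoubleTensor A ⊗[ℂ] DoubleTensor A) : extend d 1 = 0 := by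
  simp [extend]

theorem extend_mul (d : TPlus A →ₗ[ℂ] DoubleTensor A ⊗[ℂ] DoubleTensor A) (x : TPlus A)
    (w : DoubleTensor A) : extend d (TensorAlgebra.ι ℂ x * w) = d x * coproduct A w := by
  have key : ∀ (act : TPlus A →ₗ[ℂ] Module.End ℂ
      ((DoubleTensor A ⊗[ℂ] DoubleTensor A) × (DoubleTensor A ⊗[ℂ] DoubleTensor A))),
      (∀ x p, (act x p).2 = coproduct A (TensorAlgebra.ι ℂ x) * p.2) →
      ∀ w p, (TensorAlgebra.lift ℂ act w p).2 = coproduct A w * p.2 := by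
    intro act h w
    induction w using TensorAlgebra.induction with
    | algebraMap r => intro p; simp [Algebra.algebraMap_eq_smul_one]
    | ι x => intro p; simp [h]
    | mul u v hu hv => intro p; simp [hu, hv, mul_assoc]
    | add u v hu hv => intro p; simp [hu, hv, add_mul]
  simp only [extend, LinearMap.comp_apply, AlgHom.toLinearMap_apply, map_mul,
    TensorAlgebra.lift_ι_apply, LinearMap.applyₗ_apply_apply, Module.End.mul_apply]
  simp only [LinearMap.coe_mk, AddHom.coe_mk, LinearMap.comp_apply, LinearMap.prod_apply,
    Function.prod_apply, LinearMap.fst_apply, LinearMap.snd_apply, LinearMap.mulLeft_apply]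
  rw [key _ (fun x p => rfl), mul_one]

variable (A)

/-- The left half-coproduct `Δ_≺` of `H`. -/
def coproductLeft : DoubleTensor A →ₗ[ℂ] DoubleTensor A ⊗[ℂ] DoubleTensor A :=
  extend (leftHalf A)

/-- The right half-coproduct `Δ_≻` of `H`. -/
def coproductRight : DoubleTensor A →ₗ[ℂ] DoubleTensor A ⊗[ℂ] DoubleTensor A :=
  extend (rightHalf A)

/-- The Grassmann algebra `𝔾 = {z + ħ w}` with `ħ² = 0`: `fst` is `z`, `snd` is `w`. -/
abbrev Grassmann : Type := DualNumber ℂ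

variable {A}

/-- `f ≺ g = m_𝔾 (f ⊗ g) Δ_≺`. -/
def halfPrec (f g : DoubleTensor A →ₗ[ℂ] Grassmann) : DoubleTensor A →ₗ[ℂ] Grassmann :=
  LinearMap.mul' ℂ Grassmann ∘ₗ TensorProduct.map f g ∘ₗ coproductLeft A

/-- `f ≻ g = m_𝔾 (f ⊗ g) Δ_≻`. -/
def halfSucc (f g : DoubleTensor A →ₗ[ℂ] Grassmann) : DoubleTensor A →ₗ[ℂ] Grassmann :=
  LinearMap.mul' ℂ Grassmann ∘ₗ TensorProduct.map f g ∘ₗ coproductRight A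

variable (A)

/-- `ε̃ : H → 𝔾`, which is `1` at `𝟏` and vanishes on `T_+(A)^{⊗ n}` for `n ≥ 1`. -/
def counit : DoubleTensor A →ₗ[ℂ] Grassmann :=
  Algebra.linearMap ℂ Grassmann ∘ₗ TensorAlgebra.algebraMapInv.toLinearMap

variable {A}

/-- `f` is an infinitesimal character: `f(𝟏) = 0`, and `f(w_1 | w_2) = 0` for `w_1, w_2` in
`H_+ = ⨁_{n ≥ 1} T_+(A)^{⊗ n}`, the kernel of the projection of `H` onto `ℂ𝟏`. -/
def IsInfinitesimalCharacter (f : DoubleTensor A →ₗ[ℂ] Grassmann) : Prop :=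
  f 1 = 0 ∧ ∀ w₁ w₂ : DoubleTensor A, TensorAlgebra.algebraMapInv w₁ = 0 →
    TensorAlgebra.algebraMapInv w₂ = 0 → f (w₁ * w₂) = 0

/-- `φ̃ = φ + ħ φ'`. -/
def tildeFunctional (φ φ' : A →ₗ[ℂ] ℂ) : A →ₗ[ℂ] Grassmann :=
  φ.smulRight 1 + φ'.smulRight DualNumber.eps

/-- The linear map `a_1 ⋯ a_n ↦ f(a_1 ·_A ⋯ ·_A a_n)` on `T_+(A)`. -/
def onWords {M : Type*} [AddCommGroup M] [Module ℂ M] (f : A →ₗ[ℂ] M) : TPlus A →ₗ[ℂ] M :=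
  DirectSum.toModule ℂ ℕ+ _ fun n =>
    f ∘ₗ PiTensorProduct.lift (MultilinearMap.mkPiAlgebraFin ℂ (n : ℕ) A)

/-- The character `Φ : H → ℂ` with `Φ(a_1 ⋯ a_n) = φ(a_1 ·_A ⋯ ·_A a_n)`. -/
def character (φ : A →ₗ[ℂ] ℂ) : DoubleTensor A →ₐ[ℂ] ℂ :=
  TensorAlgebra.lift ℂ (onWords φ)

/-- The `𝔾`-valued character `Φ̃` with `Φ̃(a_1 ⋯ a_n) = φ̃(a_1 ·_A ⋯ ·_A a_n)`. It is `Φ + ħ Φ'`,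
where `Φ'(a_1 ⋯ a_n) = φ'(a_1 ·_A ⋯ ·_A a_n)` and
`Φ'(w_1 | w_2) = Φ(w_1) Φ'(w_2) + Φ'(w_1) Φ(w_2)`; see the facts below. -/
def tildeCharacter (φ φ' : A →ₗ[ℂ] ℂ) : DoubleTensor A →ₐ[ℂ] Grassmann :=
  TensorAlgebra.lift ℂ (onWords (tildeFunctional φ φ'))

theorem onWords_wordPlus {M : Type*} [AddCommGroup M] [Module ℂ M] (f : A →ₗ[ℂ] M) (n : ℕ+)
    (a : Fin (n : ℕ) → A) : onWords f (wordPlus (A := A) n a) = f (List.ofFn a).prod := by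
  simp [onWords, wordPlus]

theorem character_word (φ : A →ₗ[ℂ] ℂ) (n : ℕ+) (a : Fin (n : ℕ) → A) :
    character φ (word n a) = φ (List.ofFn a).prod := by
  simp [character, word, onWords_wordPlus]

theorem tildeCharacter_word (φ φ' : A →ₗ[ℂ] ℂ) (n : ℕ+) (a : Fin (n : ℕ) → A) :
    (tildeCharacter φ φ' (word n a)).snd = φ' (List.ofFn a).prod := by
  simp [tildeCharacter, word, onWords_wordPlus, tildeFunctional]

theorem tildeCharacter_fst (φ φ' : A →ₗ[ℂ] ℂ) (w : DoubleTensor A) :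
    (tildeCharacter φ φ' w).fst = character φ w := by
  have : (TrivSqZeroExt.fstHom ℂ ℂ ℂ).comp (tildeCharacter φ φ') = character φ := by
    refine TensorAlgebra.hom_ext (DirectSum.linearMap_ext _ fun n => PiTensorProduct.ext ?_)
    ext a
    change (tildeCharacter φ φ' (word n a)).fst = character φ (word n a)
    rw [character_word]
    simp [tildeCharacter, word, onWords_wordPlus, tildeFunctional]
  exact DFunLike.congr_fun this w

theorem tildeCharacter_snd_mul (φ φ' : A →ₗ[ℂ] ℂ) (w₁ w₂ : DoubleTensor A) :
    (tildeCharacter φ φ' (w₁ * w₂)).snd =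
      character φ w₁ * (tildeCharacter φ φ' w₂).snd +
        (tildeCharacter φ φ' w₁).snd * character φ w₂ := by
  rw [map_mul, ← tildeCharacter_fst φ φ', ← tildeCharacter_fst φ φ', TrivSqZeroExt.snd_mul]
  simp [mul_comm]

end Hopf

end InfShuffle

end

open InfShuffle

/-! The ħ-coefficient is handled by working over `Grassmann` throughout. Since ħ² = 0, the
ħ-coefficient of `∏ (c + ħ c')` over the blocks of `π` is `∂c_π` (`dualNumber_prod`). The two
moment-cumulant formulas are therefore the two coefficients of one formula for `dualCumulant`
(`tildeFunctional_eq_sum`), and the infinitesimal theorem becomes the ordinary one with scalars in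
𝔾.

Both half-shuffle equations reduce to words. An infinitesimal character is a derivation relative to
the counit, so by counitality `κ ≺ Φ` and `Φ ≻ β` send `w₁ | w₂`, with `w₁` in `T_+`, to their value
at `w₁` times `Φ(w₂)`. As `Φ` is multiplicative, the equations hold on `H` as soon as they hold on
words (`eq_counit_add_halfPrec_iff`, `eq_counit_add_halfSucc_iff`). There they are the recursions of
the partition sums over the block `S` of the first letter: - left: the other blocks of a
non-crossing partition are non-crossing partitions of the components of the complement of `S`,
chosen independently (`partitionSum_crosses`); - right: `β` kills every bar product of two or more
words, so only convex `S` contribute, and `S` is the first block of an interval partition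
(`partitionSum_interleaves`).

For existence, the cumulants inherit multilinearity from the moments
(`isLinearMap_of_partitionSum`), so they define a linear map on `T_+` and from it an infinitesimal
character that solves the equation. For uniqueness, the equation on a word contains the value at
that word with coefficient 1 and otherwise only values at shorter words
(`eq_on_words_of_triangular`). -/

namespace InfShuffle

/-! ### Partitions as finsets of finsets -/

section Partitions

/-- `P` is a partition of `U` into nonempty blocks. -/
structure IsPart {α : Type*} (P : Finset (Finset α)) (U : Finset α) : Prop where
  nonempty : ∀ V ∈ P, V.Nonempty
  subset : ∀ V ∈ P, V ⊆ U
  cover : ∀ x ∈ U, ∃ V ∈ P, x ∈ V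
  eq_of_mem : ∀ V ∈ P, ∀ W ∈ P, ∀ x, x ∈ V → x ∈ W → V = W

/-- No two distinct blocks of `P` are related by `r`. -/
def Avoids {α : Type*} (r : Finset α → Finset α → Prop) (P : Finset (Finset α)) : Prop :=
  ∀ V ∈ P, ∀ W ∈ P, r V W → V = W

/-- The block `W` crosses the block `V`. -/
def Crosses {α : Type*} [LinearOrder α] (V W : Finset α) : Prop :=
  ∃ i j k l, i < j ∧ j < k ∧ k < l ∧ i ∈ V ∧ k ∈ V ∧ j ∈ W ∧ l ∈ W

/-- The block `W` has an element between two elements of the block `V`. -/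
def Interleaves {α : Type*} [LinearOrder α] (V W : Finset α) : Prop :=
  ∃ i j k, i ≤ j ∧ j ≤ k ∧ i ∈ V ∧ k ∈ V ∧ j ∈ W

open Classical in
/-- The partitions of `U` that avoid `r`. -/
noncomputable def partitionsAvoiding {α : Type*} [Fintype α] (r : Finset α → Finset α → Prop)
    (U : Finset α) : Finset (Finset (Finset α)) :=
  Finset.univ.filter fun P => IsPart P U ∧ Avoids r P

theorem mem_partitionsAvoiding {α : Type*} [Fintype α] {r : Finset α → Finset α → Prop}
    {U : Finset α} {P : Finset (Finset α)} :
    P ∈ partitionsAvoiding r U ↔ IsPart P U ∧ Avoids r P := by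
  simp [partitionsAvoiding]

/-- The sum over the partitions of `U` that avoid `r` of the products of `f` over the blocks. -/
noncomputable def partitionSum {α R : Type*} [Fintype α] [CommRing R]
    (r : Finset α → Finset α → Prop) (f : Finset α → R) (U : Finset α) : R :=
  ∑ P ∈ partitionsAvoiding r U, ∏ V ∈ P, f V

variable {R : Type*} [CommRing R]

theorem isPart_parts {α : Type*} [DecidableEq α] {U : Finset α} (π : Finpartition U) :
    IsPart π.parts U where
  nonempty _ hV := π.nonempty_of_mem_parts hV
  subset _ hV := π.le hV
  cover _ hx := π.exists_mem hx
  eq_of_mem _ hV _ hW _ h h' := π.eq_of_mem_parts hV hW h h'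

theorem exists_finpartition {α : Type*} [DecidableEq α] {U : Finset α} {P : Finset (Finset α)}
    (h : IsPart P U) : ∃ π : Finpartition U, π.parts = P := by
  refine ⟨⟨P, ?_, ?_, ?_⟩, rfl⟩
  · rw [Finset.supIndep_iff_pairwiseDisjoint]
    intro V hV W hW hne
    exact Finset.disjoint_left.mpr fun x hx hx' => hne (h.eq_of_mem V hV W hW x hx hx')
  · ext x
    rw [Finset.mem_sup]
    exact ⟨fun ⟨V, hV, hx⟩ => h.subset V hV hx, fun hx => h.cover x hx⟩
  · intro h0
    exact Finset.not_nonempty_empty (h.nonempty _ h0)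

/-- With finsets of finsets, partitions of different sets `U` share one type, so blocks can be
inserted and erased without casts. A single relation `r` then covers `NC` and `IntervalPartitions`
alike. -/
theorem sum_finpartition {n : ℕ} (r : Finset (Fin n) → Finset (Fin n) → Prop)
    (s : Finset (Finpartition (Finset.univ : Finset (Fin n))))
    (hs : ∀ π, π ∈ s ↔ Avoids r π.parts) (f : Finset (Fin n) → R) :
    ∑ π ∈ s, ∏ V ∈ π.parts, f V = partitionSum r f Finset.univ := by
  refine Finset.sum_bij (fun π _ => π.parts) ?_ ?_ ?_ ?_
  · intro π hπ
    exact mem_partitionsAvoiding.mpr ⟨isPart_parts π, (hs π).mp hπ⟩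
  · intro π _ π' _ h
    exact Finpartition.ext h
  · intro P hP
    rw [mem_partitionsAvoiding] at hP
    obtain ⟨π, rfl⟩ := exists_finpartition hP.1
    exact ⟨π, (hs π).mpr hP.2, rfl⟩
  · intros
    rfl

theorem mem_NC_iff {n : ℕ} (π : Finpartition (Finset.univ : Finset (Fin n))) :
    π ∈ NC n ↔ Avoids Crosses π.parts := by
  simp only [NC, Finset.mem_filter, Finset.mem_univ, true_and]
  constructor
  · rintro h V hV W hW ⟨i, j, k, l, h1, h2, h3, h4, h5, h6, h7⟩
    exact h V hV W hW i j k l h1 h2 h3 h4 h5 h6 h7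
  · intro h V hV W hW i j k l h1 h2 h3 h4 h5 h6 h7
    exact h V hV W hW ⟨i, j, k, l, h1, h2, h3, h4, h5, h6, h7⟩

/-- Convexity concerns one block at a time. It becomes a condition on pairs because the intermediate
point `j` lies in some block, which must then be `V`. -/
theorem mem_intervalPartitions_iff {n : ℕ} (π : Finpartition (Finset.univ : Finset (Fin n))) :
    π ∈ IntervalPartitions n ↔ Avoids Interleaves π.parts := by
  simp only [IntervalPartitions, Finset.mem_filter, Finset.mem_univ, true_and]
  constructor
  · rintro h V hV W hW ⟨i, j, k, h1, h2, h3, h4, h5⟩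
    exact π.eq_of_mem_parts hV hW (h V hV i h3 k h4 j h1 h2) h5
  · intro h V hV i hi k hk j h1 h2
    obtain ⟨W, hW, hj⟩ := π.exists_mem (Finset.mem_univ j)
    exact h V hV W hW ⟨i, j, k, h1, h2, hi, hk, hj⟩ ▸ hj

/-! ### Transport along order embeddings -/

theorem crosses_map {m n : ℕ} (e : Fin m ↪o Fin n) (V W : Finset (Fin m)) :
    Crosses (V.map e.toEmbedding) (W.map e.toEmbedding) ↔ Crosses V W := by
  constructor
  · rintro ⟨i, j, k, l, h1, h2, h3, h4, h5, h6, h7⟩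
    rw [Finset.mem_map] at h4 h5 h6 h7
    obtain ⟨i, hi', rfl⟩ := h4
    obtain ⟨k, hk', rfl⟩ := h5
    obtain ⟨j, hj', rfl⟩ := h6
    obtain ⟨l, hl', rfl⟩ := h7
    exact ⟨i, j, k, l, e.lt_iff_lt.mp h1, e.lt_iff_lt.mp h2, e.lt_iff_lt.mp h3, hi', hk', hj', hl'⟩
  · rintro ⟨i, j, k, l, h1, h2, h3, h4, h5, h6, h7⟩
    exact ⟨e i, e j, e k, e l, e.lt_iff_lt.mpr h1, e.lt_iff_lt.mpr h2, e.lt_iff_lt.mpr h3,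
      Finset.mem_map_of_mem _ h4, Finset.mem_map_of_mem _ h5, Finset.mem_map_of_mem _ h6,
      Finset.mem_map_of_mem _ h7⟩

theorem interleaves_map {m n : ℕ} (e : Fin m ↪o Fin n) (V W : Finset (Fin m)) :
    Interleaves (V.map e.toEmbedding) (W.map e.toEmbedding) ↔ Interleaves V W := by
  constructor
  · rintro ⟨i, j, k, h1, h2, h4, h5, h6⟩
    rw [Finset.mem_map] at h4 h5 h6
    obtain ⟨i, hi', rfl⟩ := h4
    obtain ⟨k, hk', rfl⟩ := h5
    obtain ⟨j, hj', rfl⟩ := h6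
    exact ⟨i, j, k, e.le_iff_le.mp h1, e.le_iff_le.mp h2, hi', hk', hj'⟩
  · rintro ⟨i, j, k, h1, h2, h4, h5, h6⟩
    exact ⟨e i, e j, e k, e.le_iff_le.mpr h1, e.le_iff_le.mpr h2,
      Finset.mem_map_of_mem _ h4, Finset.mem_map_of_mem _ h5, Finset.mem_map_of_mem _ h6⟩

theorem isPart_map {α β : Type*} (e : α ↪ β) (P : Finset (Finset α)) (U : Finset α) :
    IsPart (P.map (Finset.mapEmbedding e).toEmbedding) (U.map e) ↔ IsPart P U := by
  constructor
  · intro h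
    refine ⟨fun V hV => ?_, fun V hV => ?_, fun x hx => ?_, fun V hV W hW x h1 h2 => ?_⟩
    · simpa using h.nonempty _ (Finset.mem_map_of_mem _ hV)
    · simpa using h.subset _ (Finset.mem_map_of_mem _ hV)
    · obtain ⟨V, hV, hx⟩ := h.cover _ (Finset.mem_map_of_mem e hx)
      obtain ⟨V, hV', rfl⟩ := Finset.mem_map.mp hV
      exact ⟨V, hV', (Finset.mem_map' e).mp hx⟩
    · exact (Finset.mapEmbedding e).injective (h.eq_of_mem _ (Finset.mem_map_of_mem _ hV) _
        (Finset.mem_map_of_mem _ hW) (e x) (Finset.mem_map_of_mem e h1)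
        (Finset.mem_map_of_mem e h2))
  · intro h
    refine ⟨fun V hV => ?_, fun V hV => ?_, fun x hx => ?_, fun V hV W hW x h1 h2 => ?_⟩
    · obtain ⟨V, hV', rfl⟩ := Finset.mem_map.mp hV
      simpa using h.nonempty _ hV'
    · obtain ⟨V, hV', rfl⟩ := Finset.mem_map.mp hV
      simpa using h.subset _ hV'
    · obtain ⟨x, hx', rfl⟩ := Finset.mem_map.mp hx
      obtain ⟨V, hV, hx⟩ := h.cover _ hx'
      exact ⟨_, Finset.mem_map_of_mem _ hV, Finset.mem_map_of_mem e hx⟩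
    · obtain ⟨V, hV', rfl⟩ := Finset.mem_map.mp hV
      obtain ⟨W, hW', rfl⟩ := Finset.mem_map.mp hW
      obtain ⟨x, hx', rfl⟩ := Finset.mem_map.mp h1
      rw [h.eq_of_mem V hV' W hW' x hx' ((Finset.mem_map' e).mp h2)]

theorem avoids_map {α β : Type*} (e : α ↪ β) (P : Finset (Finset α))
    {r : Finset α → Finset α → Prop} {r' : Finset β → Finset β → Prop}
    (hr : ∀ V W, r' (V.map e) (W.map e) ↔ r V W) :
    Avoids r' (P.map (Finset.mapEmbedding e).toEmbedding) ↔ Avoids r P := by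
  constructor
  · intro h V hV W hW h1
    exact (Finset.mapEmbedding e).injective (h _ (Finset.mem_map_of_mem _ hV) _
        (Finset.mem_map_of_mem _ hW) ((hr V W).mpr h1))
  · intro h V hV W hW h1
    obtain ⟨V, hV', rfl⟩ := Finset.mem_map.mp hV
    obtain ⟨W, hW', rfl⟩ := Finset.mem_map.mp hW
    rw [h V hV' W hW' ((hr V W).mp h1)]

/-- Applied to the increasing enumeration of `J`, this identifies partitions of `J` with partitions
of `Fin J.card`. It is bijective on partitions because every block lies inside `U.map e` and so is
the image of a unique finset. -/
theorem partitionSum_map {α β : Type*} [Fintype α] [Fintype β] (e : α ↪ β)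
    {r : Finset α → Finset α → Prop} {r' : Finset β → Finset β → Prop}
    (hr : ∀ V W, r' (V.map e) (W.map e) ↔ r V W) (f : Finset β → R) (U : Finset α) :
    partitionSum r' f (U.map e) = partitionSum r (fun V => f (V.map e)) U := by
  classical
  symm
  refine Finset.sum_bij (fun P _ => P.map (Finset.mapEmbedding e).toEmbedding) ?_ ?_ ?_ ?_
  · intro P hP
    rw [mem_partitionsAvoiding] at *
    exact ⟨(isPart_map e P U).mpr hP.1, (avoids_map e P hr).mpr hP.2⟩
  · intro P _ Q _ h
    exact Finset.map_injective _ h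
  · intro Q hQ
    rw [mem_partitionsAvoiding] at hQ
    have key : (Finset.univ.filter fun V : Finset α => V.map e ∈ Q).map
        (Finset.mapEmbedding e).toEmbedding = Q := by
      ext W
      rw [Finset.mem_map]
      constructor
      · rintro ⟨V, hV, rfl⟩
        exact (Finset.mem_filter.mp hV).2
      · intro hW
        obtain ⟨V, -, rfl⟩ := Finset.subset_map_iff.mp (hQ.1.subset W hW)
        exact ⟨V, Finset.mem_filter.mpr ⟨Finset.mem_univ _, hW⟩, rfl⟩
    refine ⟨_, ?_, key⟩
    rw [mem_partitionsAvoiding]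
    rw [← key] at hQ
    exact ⟨(isPart_map e _ U).mp hQ.1, (avoids_map e _ hr).mp hQ.2⟩
  · intro P _
    rw [Finset.prod_map]
    rfl

/-! ### Recursion over the block of a point -/

theorem IsPart.insert {α : Type*} [Fintype α] [DecidableEq α] {S : Finset α}
    {Q : Finset (Finset α)} (h : IsPart Q Sᶜ) (hS : S.Nonempty) :
    IsPart (insert S Q) Finset.univ where
  nonempty := by
    intro V hV
    rcases Finset.mem_insert.mp hV with rfl | hV
    · exact hS
    · exact h.nonempty V hV
  subset _ _ := Finset.subset_univ _
  cover := by
    intro x _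
    by_cases hx : x ∈ S
    · exact ⟨S, Finset.mem_insert_self _ _, hx⟩
    · obtain ⟨V, hV, hx⟩ := h.cover x (Finset.mem_compl.mpr hx)
      exact ⟨V, Finset.mem_insert_of_mem hV, hx⟩
  eq_of_mem := by
    intro V hV W hW x hx hx'
    rcases Finset.mem_insert.mp hV with rfl | hV' <;> rcases Finset.mem_insert.mp hW with rfl | hW'
    · rfl
    · exact absurd hx (Finset.mem_compl.mp (h.subset W hW' hx'))
    · exact absurd hx' (Finset.mem_compl.mp (h.subset V hV' hx))
    · exact h.eq_of_mem V hV' W hW' x hx hx'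

theorem IsPart.erase {α : Type*} [Fintype α] [DecidableEq α] {S : Finset α}
    {P : Finset (Finset α)} (h : IsPart P Finset.univ) (hS : S ∈ P) :
    IsPart (P.erase S) Sᶜ where
  nonempty V hV := h.nonempty V (Finset.mem_of_mem_erase hV)
  subset V hV x hx := Finset.mem_compl.mpr fun hx' =>
    Finset.ne_of_mem_erase hV (h.eq_of_mem V (Finset.mem_of_mem_erase hV) S hS x hx hx')
  cover x hx := by
    obtain ⟨V, hV, hxV⟩ := h.cover x (Finset.mem_univ _)
    refine ⟨V, Finset.mem_erase.mpr ⟨?_, hV⟩, hxV⟩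
    rintro rfl
    exact Finset.mem_compl.mp hx hxV
  eq_of_mem V hV W hW := h.eq_of_mem V (Finset.mem_of_mem_erase hV) W (Finset.mem_of_mem_erase hW)

theorem IsPart.notMem {α : Type*} [Fintype α] [DecidableEq α] {S : Finset α}
    {Q : Finset (Finset α)} (h : IsPart Q Sᶜ) (hS : S.Nonempty) : S ∉ Q := fun hQ =>
  let ⟨_, hx⟩ := hS
  Finset.mem_compl.mp (h.subset S hQ hx) hx

open Classical in
-- A partition corresponds to the block `S` of `z` together with the remaining blocks `Q`. The
-- condition on `insert S Q` is left unsimplified, since what it means for `Q` depends on `r`.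
theorem partitionSum_univ {α : Type*} [Fintype α] [DecidableEq α] (r : Finset α → Finset α → Prop)
    (f : Finset α → R) (z : α) :
    partitionSum r f Finset.univ = ∑ S ∈ Finset.univ.filter fun S : Finset α => z ∈ S,
      f S * ∑ Q ∈ Finset.univ.filter fun Q => IsPart Q Sᶜ ∧ Avoids r (insert S Q),
        ∏ V ∈ Q, f V := by
  simp_rw [Finset.mul_sum]
  rw [Finset.sum_sigma', partitionSum]
  symm
  refine Finset.sum_bij (fun p _ => insert p.1 p.2) ?_ ?_ ?_ ?_
  · rintro ⟨S, Q⟩ h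
    simp only [Finset.mem_sigma, Finset.mem_filter, Finset.mem_univ, true_and] at h
    exact mem_partitionsAvoiding.mpr ⟨h.2.1.insert ⟨z, h.1⟩, h.2.2⟩
  · rintro ⟨S, Q⟩ h ⟨S', Q'⟩ h' he
    simp only [Finset.mem_sigma, Finset.mem_filter, Finset.mem_univ, true_and] at h h' he
    have hP := h.2.1.insert ⟨z, h.1⟩
    have hS : S = S' := hP.eq_of_mem S (Finset.mem_insert_self _ _) S'
      (he ▸ Finset.mem_insert_self _ _) z h.1 h'.1
    subst hS
    have hQ : Q = Q' := by
      rw [← Finset.erase_insert (h.2.1.notMem ⟨z, h.1⟩), he,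
        Finset.erase_insert (h'.2.1.notMem ⟨z, h.1⟩)]
    rw [hQ]
  · intro P hP
    rw [mem_partitionsAvoiding] at hP
    obtain ⟨S, hS, hz⟩ := hP.1.cover z (Finset.mem_univ z)
    refine ⟨⟨S, P.erase S⟩, ?_, Finset.insert_erase hS⟩
    simp only [Finset.mem_sigma, Finset.mem_filter, Finset.mem_univ, true_and]
    exact ⟨hz, hP.1.erase hS, (Finset.insert_erase hS).symm ▸ hP.2⟩
  · rintro ⟨S, Q⟩ h
    simp only [Finset.mem_sigma, Finset.mem_filter, Finset.mem_univ, true_and] at h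
    exact (Finset.prod_insert (h.2.1.notMem ⟨z, h.1⟩)).symm

/-- `V` is convex. -/
def IsInterval {α : Type*} [LinearOrder α] (V : Finset α) : Prop :=
  ∀ i ∈ V, ∀ k ∈ V, ∀ j, i ≤ j → j ≤ k → j ∈ V

open Classical in
-- As `z` is least, a convex `S` containing it is an initial segment, and all other blocks lie
-- beyond it; adding `S` then imposes no further condition on `Q`.
theorem partitionSum_interleaves {α : Type*} [Fintype α] [LinearOrder α]
    (f : Finset α → R) (z : α) (hz : ∀ x, z ≤ x) :
    partitionSum Interleaves f Finset.univ = ∑ S ∈ Finset.univ.filter fun S : Finset α => z ∈ S,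
      f S * if IsInterval S then partitionSum Interleaves f Sᶜ else 0 := by
  rw [partitionSum_univ _ f z]
  refine Finset.sum_congr rfl fun S hS => ?_
  have hzS := (Finset.mem_filter.mp hS).2
  congr 1
  split_ifs with hI
  · refine Finset.sum_congr ?_ fun _ _ => rfl
    ext Q
    rw [mem_partitionsAvoiding, Finset.mem_filter, and_iff_right (Finset.mem_univ _)]
    refine and_congr_right fun hQ => ⟨fun h V hV W hW => h V (Finset.mem_insert_of_mem hV) W
      (Finset.mem_insert_of_mem hW), ?_⟩
    rintro h V hV W hW ⟨i, j, k, h1, h2, h3, h4, h5⟩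
    rcases Finset.mem_insert.mp hV with rfl | hV' <;> rcases Finset.mem_insert.mp hW with rfl | hW'
    · rfl
    · exact absurd (hI i h3 k h4 j h1 h2) (Finset.mem_compl.mp (hQ.subset W hW' h5))
    -- Here `z ≤ i ≤ j` with `z` and `j` in the convex block, so `i` would lie in it too.
    · exact absurd (hI z hzS j h5 i (hz i) h1) (Finset.mem_compl.mp (hQ.subset V hV' h3))
    · exact h V hV' W hW' ⟨i, j, k, h1, h2, h3, h4, h5⟩
  -- A gap `j` of a non-convex `S` belongs to another block, which `S` then interleaves: no `Q` is
  -- admissible.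
  · refine Finset.sum_eq_zero fun Q hQ => absurd ?_ hI
    simp only [Finset.mem_filter, Finset.mem_univ, true_and] at hQ
    intro i hi k hk j h1 h2
    by_contra hj
    obtain ⟨W, hW, hjW⟩ := hQ.1.cover j (Finset.mem_compl.mpr hj)
    exact hj (hQ.2 S (Finset.mem_insert_self _ _) W (Finset.mem_insert_of_mem hW)
      ⟨i, j, k, h1, h2, hi, hk, hjW⟩ ▸ hjW)

/-! ### Components -/

theorem mem_components {n : ℕ} {U J : Finset (Fin n)} :
    J ∈ components U ↔ ∃ i ∈ U, component U i = J := by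
  constructor
  · intro h
    rw [components, List.mem_map] at h
    obtain ⟨i, hi, h⟩ := h
    rw [Finset.mem_sort, Finset.mem_filter] at hi
    exact ⟨i, hi.1, h⟩
  · rintro ⟨i, hi, rfl⟩
    obtain ⟨V, hV, hiV⟩ := exists_mem_components.mpr hi
    have h := hV
    rw [components, List.mem_map] at h
    obtain ⟨j, -, rfl⟩ := h
    rwa [component_eq hiV]

theorem isInterval_component {n : ℕ} (U : Finset (Fin n)) (i : Fin n) :
    IsInterval (component U i) := by
  intro a ha b hb c hac hcb
  rw [mem_component] at *
  intro k hk
  by_cases h : (i ≤ k ∧ k ≤ b) ∨ (b ≤ k ∧ k ≤ i)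
  · exact hb k h
  · exact ha k (by omega)

theorem nodup_components {n : ℕ} (U : Finset (Fin n)) : (components U).Nodup := by
  refine (components_pairwise U).imp_of_mem ?_
  rintro V W hV - h rfl
  obtain ⟨i, hi, rfl⟩ := mem_components.mp hV
  exact Finset.disjoint_left.mp h (self_mem_component hi) (self_mem_component hi)

theorem eq_of_mem_components {n : ℕ} {U J J' : Finset (Fin n)} (hJ : J ∈ components U)
    (hJ' : J' ∈ components U) {x : Fin n} (hx : x ∈ J) (hx' : x ∈ J') : J = J' := by
  obtain ⟨i, -, rfl⟩ := mem_components.mp hJ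
  obtain ⟨j, -, rfl⟩ := mem_components.mp hJ'
  exact (component_eq hx).symm.trans (component_eq hx')

theorem subset_of_mem_components {n : ℕ} {U J : Finset (Fin n)} (hJ : J ∈ components U) :
    J ⊆ U := by
  obtain ⟨i, -, rfl⟩ := mem_components.mp hJ
  exact fun x hx => component_subset hx

theorem IsInterval.of_mem_components {n : ℕ} {U J : Finset (Fin n)} (hJ : J ∈ components U) :
    IsInterval J := by
  obtain ⟨i, -, rfl⟩ := mem_components.mp hJ
  exact isInterval_component U i

theorem nonempty_of_mem_components {n : ℕ} {U J : Finset (Fin n)} (hJ : J ∈ components U) :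
    J.Nonempty := by
  obtain ⟨i, hi, rfl⟩ := mem_components.mp hJ
  exact ⟨i, self_mem_component hi⟩

open Classical in
-- A block with points on both sides of some `k ∈ S` is crossed with `S` through `z` and `k`, so
-- each remaining block stays inside one component. Conversely, components are convex and disjoint
-- from `S`, so gluing non-crossing partitions of them creates no new crossing. The product of sums
-- is expanded over choice functions `p`, and `p` corresponds to the union of its values.
theorem sum_avoids_crosses {n : ℕ} (f : Finset (Fin n) → R) (z : Fin n) (hz : ∀ x, z ≤ x)
    {S : Finset (Fin n)} (hzS : z ∈ S) :
    ∑ Q ∈ Finset.univ.filter fun Q => IsPart Q Sᶜ ∧ Avoids Crosses (insert S Q), ∏ V ∈ Q, f V =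
      ∏ J ∈ (components Sᶜ).toFinset, partitionSum Crosses f J := by
  -- Away from the components the only choice is the empty family, with product 1; this lets `p` be
  -- a function on all finsets.
  let t : Finset (Fin n) → Finset (Finset (Finset (Fin n))) := fun J =>
    if J ∈ components Sᶜ then partitionsAvoiding Crosses J else {∅}
  have htmem : ∀ {p : Finset (Fin n) → Finset (Finset (Fin n))}, p ∈ Fintype.piFinset t →
      ∀ {J V}, V ∈ p J → J ∈ components Sᶜ ∧ IsPart (p J) J ∧ Avoids Crosses (p J) := by
    intro p hp J V hV
    have := Fintype.mem_piFinset.mp hp J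
    by_cases hJ : J ∈ components Sᶜ
    · simp only [t, if_pos hJ] at this
      exact ⟨hJ, mem_partitionsAvoiding.mp this⟩
    · simp only [t, if_neg hJ, Finset.mem_singleton] at this
      simp [this] at hV
  have hR : ∏ J ∈ (components Sᶜ).toFinset, partitionSum Crosses f J =
      ∑ p ∈ Fintype.piFinset t, ∏ J, ∏ V ∈ p J, f V := by
    rw [← Finset.prod_univ_sum t (fun _ P => ∏ V ∈ P, f V),
      ← Finset.prod_subset (Finset.subset_univ (components Sᶜ).toFinset)]
    · refine Finset.prod_congr rfl fun J hJ => ?_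
      simp only [t, if_pos (List.mem_toFinset.mp hJ)]
      rfl
    · intro J _ hJ
      simp [t, mt List.mem_toFinset.mpr hJ]
  -- The choice `p` is recovered from its union, because blocks are nonempty and components are
  -- disjoint.
  have hbi : ∀ p ∈ Fintype.piFinset t, ∀ J ∈ components Sᶜ,
      (Finset.univ.biUnion p).filter (· ⊆ J) = p J := by
    intro p hp J hJ
    ext V
    simp only [Finset.mem_filter, Finset.mem_biUnion, Finset.mem_univ, true_and]
    constructor
    · rintro ⟨⟨J', hV⟩, hVJ⟩
      obtain ⟨hJ', h1, -⟩ := htmem hp hV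
      obtain ⟨x, hx⟩ := h1.nonempty V hV
      rwa [eq_of_mem_components hJ hJ' (hVJ hx) (h1.subset V hV hx)]
    · intro hV
      exact ⟨⟨J, hV⟩, (htmem hp hV).2.1.subset V hV⟩
  rw [hR]
  symm
  refine Finset.sum_bij (fun p _ => Finset.univ.biUnion p) ?_ ?_ ?_ ?_
  · intro p hp
    simp only [Finset.mem_filter, Finset.mem_univ, true_and]
    refine ⟨⟨?_, ?_, ?_, ?_⟩, ?_⟩
    · intro V hV
      obtain ⟨J, -, hV⟩ := Finset.mem_biUnion.mp hV
      exact (htmem hp hV).2.1.nonempty V hV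
    · intro V hV
      obtain ⟨J, -, hV⟩ := Finset.mem_biUnion.mp hV
      exact ((htmem hp hV).2.1.subset V hV).trans (subset_of_mem_components (htmem hp hV).1)
    · intro x hx
      obtain ⟨J, hJ, hxJ⟩ := exists_mem_components.mpr hx
      have h := Fintype.mem_piFinset.mp hp J
      simp only [t, if_pos hJ] at h
      obtain ⟨V, hV, hxV⟩ := (mem_partitionsAvoiding.mp h).1.cover x hxJ
      exact ⟨V, Finset.mem_biUnion.mpr ⟨J, Finset.mem_univ _, hV⟩, hxV⟩
    · intro V hV W hW x hx hx'
      obtain ⟨J, -, hV⟩ := Finset.mem_biUnion.mp hV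
      obtain ⟨J', -, hW⟩ := Finset.mem_biUnion.mp hW
      obtain ⟨hJ, h1, -⟩ := htmem hp hV
      obtain ⟨hJ', h1', -⟩ := htmem hp hW
      obtain rfl := eq_of_mem_components hJ hJ' (h1.subset V hV hx) (h1'.subset W hW hx')
      exact h1.eq_of_mem V hV W hW x hx hx'
    · rintro V hV W hW ⟨i, j, k, l, h1, h2, h3, hi, hk, hj, hl⟩
      rcases Finset.mem_insert.mp hV with rfl | hV' <;>
        rcases Finset.mem_insert.mp hW with rfl | hW'
      · rfl
      · obtain ⟨J, -, hW⟩ := Finset.mem_biUnion.mp hW'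
        obtain ⟨hJ, hp', -⟩ := htmem hp hW
        have := IsInterval.of_mem_components hJ j (hp'.subset W hW hj) l (hp'.subset W hW hl) k
          h2.le h3.le
        exact absurd hk (Finset.mem_compl.mp (subset_of_mem_components hJ this))
      · obtain ⟨J, -, hV⟩ := Finset.mem_biUnion.mp hV'
        obtain ⟨hJ, hp', -⟩ := htmem hp hV
        have := IsInterval.of_mem_components hJ i (hp'.subset V hV hi) k (hp'.subset V hV hk) j
          h1.le h2.le
        exact absurd hj (Finset.mem_compl.mp (subset_of_mem_components hJ this))
      · obtain ⟨J, -, hV⟩ := Finset.mem_biUnion.mp hV'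
        obtain ⟨J', -, hW⟩ := Finset.mem_biUnion.mp hW'
        obtain ⟨hJ, hp', ha⟩ := htmem hp hV
        obtain ⟨hJ', hp'', -⟩ := htmem hp hW
        have := IsInterval.of_mem_components hJ i (hp'.subset V hV hi) k (hp'.subset V hV hk) j
          h1.le h2.le
        obtain rfl := eq_of_mem_components hJ hJ' this (hp''.subset W hW hj)
        exact ha V hV W hW ⟨i, j, k, l, h1, h2, h3, hi, hk, hj, hl⟩
  · intro p hp q hq h
    funext J
    by_cases hJ : J ∈ components Sᶜ
    · rw [← hbi p hp J hJ, ← hbi q hq J hJ]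
      exact congrArg _ h
    · have h1 := Fintype.mem_piFinset.mp hp J
      have h2 := Fintype.mem_piFinset.mp hq J
      simp only [t, if_neg hJ, Finset.mem_singleton] at h1 h2
      rw [h1, h2]
  · intro Q hQ
    simp only [Finset.mem_filter, Finset.mem_univ, true_and] at hQ
    obtain ⟨hQ, hA⟩ := hQ
    -- If `k ∈ S` separated two points of `V`, say `x < k < y`, then `z < x < k < y` would be a
    -- crossing of `S` and `V`.
    have hsub : ∀ V ∈ Q, ∀ J ∈ components Sᶜ, ∀ x ∈ V, x ∈ J → V ⊆ J := by
      intro V hV J hJ x hx hxJ y hy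
      obtain ⟨i, -, rfl⟩ := mem_components.mp hJ
      rw [← component_eq hxJ, mem_component]
      intro k hk
      rw [Finset.mem_compl]
      intro hkS
      have hne : ∀ w ∈ V, w ≠ k := by
        rintro w hw rfl
        exact Finset.mem_compl.mp (hQ.subset V hV hw) hkS
      have hne' : ∀ w ∈ V, z < w := by
        intro w hw
        refine lt_of_le_of_ne (hz w) ?_
        rintro rfl
        exact Finset.mem_compl.mp (hQ.subset V hV hw) hzS
      have hSV : S = V := by
        rcases hk with hk | hk
        · exact hA S (Finset.mem_insert_self _ _) V (Finset.mem_insert_of_mem hV)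
            ⟨z, x, k, y, hne' x hx, lt_of_le_of_ne hk.1 (hne x hx),
              lt_of_le_of_ne hk.2 (hne y hy).symm, hzS, hkS, hx, hy⟩
        · exact hA S (Finset.mem_insert_self _ _) V (Finset.mem_insert_of_mem hV)
            ⟨z, y, k, x, hne' y hy, lt_of_le_of_ne hk.1 (hne y hy),
              lt_of_le_of_ne hk.2 (hne x hx).symm, hzS, hkS, hy, hx⟩
      exact hQ.notMem ⟨z, hzS⟩ (hSV ▸ hV)
    refine ⟨fun J => if J ∈ components Sᶜ then Q.filter (· ⊆ J) else ∅, ?_, ?_⟩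
    · rw [Fintype.mem_piFinset]
      intro J
      by_cases hJ : J ∈ components Sᶜ
      · simp only [t, if_pos hJ, mem_partitionsAvoiding]
        refine ⟨⟨fun V hV => hQ.nonempty V (Finset.mem_filter.mp hV).1,
          fun V hV => (Finset.mem_filter.mp hV).2, ?_, fun V hV W hW => hQ.eq_of_mem V
          (Finset.mem_filter.mp hV).1 W (Finset.mem_filter.mp hW).1⟩, ?_⟩
        · intro x hx
          obtain ⟨V, hV, hxV⟩ := hQ.cover x (subset_of_mem_components hJ hx)
          exact ⟨V, Finset.mem_filter.mpr ⟨hV, hsub V hV J hJ x hxV hx⟩, hxV⟩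
        · intro V hV W hW
          exact hA V (Finset.mem_insert_of_mem (Finset.mem_filter.mp hV).1) W
            (Finset.mem_insert_of_mem (Finset.mem_filter.mp hW).1)
      · simp [t, hJ]
    · ext V
      simp only [Finset.mem_biUnion, Finset.mem_univ, true_and]
      constructor
      · rintro ⟨J, hV⟩
        split_ifs at hV
        · exact (Finset.mem_filter.mp hV).1
        · simp at hV
      · intro hV
        obtain ⟨x, hx⟩ := hQ.nonempty V hV
        obtain ⟨J, hJ, hxJ⟩ := exists_mem_components.mpr (hQ.subset V hV hx)
        refine ⟨J, ?_⟩
        rw [if_pos hJ]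
        exact Finset.mem_filter.mpr ⟨hV, hsub V hV J hJ x hx hxJ⟩
  · intro p hp
    refine (Finset.prod_biUnion ?_).symm
    intro J _ J' _ hne
    refine Finset.disjoint_left.mpr fun V hV hV' => hne ?_
    obtain ⟨hJ, h1, -⟩ := htmem hp hV
    obtain ⟨hJ', h1', -⟩ := htmem hp hV'
    obtain ⟨x, hx⟩ := h1.nonempty V hV
    exact eq_of_mem_components hJ hJ' (h1.subset V hV hx) (h1'.subset V hV' hx)

theorem partitionSum_crosses {n : ℕ} (f : Finset (Fin n) → R) (z : Fin n) (hz : ∀ x, z ≤ x) :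
    partitionSum Crosses f Finset.univ =
      ∑ S ∈ Finset.univ.filter fun S : Finset (Fin n) => z ∈ S,
        f S * ((components Sᶜ).map (partitionSum Crosses f)).prod := by
  classical
  rw [partitionSum_univ _ f z]
  refine Finset.sum_congr rfl fun S hS => ?_
  rw [← List.prod_toFinset _ (nodup_components _),
    ← sum_avoids_crosses f z hz (Finset.mem_filter.mp hS).2]

end Partitions

/-! ### Characters and infinitesimal characters -/

section Restrict

variable {A X : Type*}

/-- An order embedding of `Fin k` into a set of `k` elements is its increasing enumeration. Leaving
`k` free lets `subst` absorb the casts between equal cardinalities. -/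
theorem apply_restrict_eq (g : ∀ n : ℕ, (Fin n → A) → X) {n k : ℕ} (a : Fin n → A)
    {S : Finset (Fin n)} (hk : S.card = k) (e : Fin k ↪o Fin n) (he : ∀ x, e x ∈ S) :
    g S.card (restrict a S) = g k (a ∘ e) := by
  subst hk
  congr 1
  funext i
  rw [restrict, Finset.orderEmbOfFin_unique' rfl he]
  rfl

theorem apply_restrict_univ (g : ∀ n : ℕ, (Fin n → A) → X) {n : ℕ} (a : Fin n → A) :
    g (Finset.univ : Finset (Fin n)).card (restrict a Finset.univ) = g n a :=
  apply_restrict_eq g a (by simp) (RelEmbedding.refl _) fun _ => Finset.mem_univ _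

theorem apply_restrict_map (g : ∀ n : ℕ, (Fin n → A) → X) {m n : ℕ} (e : Fin m ↪o Fin n)
    (a : Fin n → A) (V : Finset (Fin m)) :
    g (V.map e.toEmbedding).card (restrict a (V.map e.toEmbedding)) =
      g V.card (restrict (a ∘ e) V) :=
  apply_restrict_eq g a (Finset.card_map _) ((V.orderEmbOfFin rfl).trans e) fun x =>
    Finset.mem_map_of_mem _ (Finset.orderEmbOfFin_mem V rfl x)

end Restrict

section Characters

variable {A : Type*} [Ring A] [Algebra ℂ A]

/-- `m_𝔾 (f ⊗ g)`. -/
noncomputable def pairing (f g : DoubleTensor A →ₗ[ℂ] Grassmann) :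
    DoubleTensor A ⊗[ℂ] DoubleTensor A →ₗ[ℂ] Grassmann :=
  LinearMap.mul' ℂ Grassmann ∘ₗ TensorProduct.map f g

@[simp]
theorem pairing_tmul (f g : DoubleTensor A →ₗ[ℂ] Grassmann) (u v : DoubleTensor A) :
    pairing f g (u ⊗ₜ v) = f u * g v := by
  simp [pairing]

theorem counit_eq (w : DoubleTensor A) :
    counit A w = algebraMap ℂ Grassmann (TensorAlgebra.algebraMapInv w) := rfl

theorem counit_mul (u v : DoubleTensor A) : counit A (u * v) = counit A u * counit A v := by
  simp only [counit_eq, map_mul]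

theorem counit_one : counit A 1 = 1 := by
  simp only [counit_eq, map_one]

/-- Subtracting from `u` and `v` their counits leaves elements of `H_+`, whose product `κ` kills;
expand and use `κ 1 = 0`. -/
theorem IsInfinitesimalCharacter.map_mul {κ : DoubleTensor A →ₗ[ℂ] Grassmann}
    (h : IsInfinitesimalCharacter κ) (u v : DoubleTensor A) :
    κ (u * v) = counit A u * κ v + counit A v * κ u := by
  have key : ∀ w : DoubleTensor A,
      TensorAlgebra.algebraMapInv (w - algebraMap ℂ _ (TensorAlgebra.algebraMapInv w)) = 0 := by
    intro w
    rw [map_sub, TensorAlgebra.algebraMapInv, AlgHom.commutes]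
    simp
  have h2 := h.2 _ _ (key u) (key v)
  simp only [sub_mul, mul_sub, map_sub, Algebra.algebraMap_eq_smul_one, smul_mul_assoc,
    mul_smul_comm, one_mul, mul_one, map_smul, h.1, smul_zero, sub_zero] at h2
  rw [sub_sub, sub_eq_zero] at h2
  rw [h2, counit_eq, counit_eq, Algebra.algebraMap_eq_smul_one, Algebra.algebraMap_eq_smul_one,
    smul_one_mul, smul_one_mul, add_comm]

theorem IsInfinitesimalCharacter.map_mul_of_counit_eq_zero
    {κ : DoubleTensor A →ₗ[ℂ] Grassmann} (h : IsInfinitesimalCharacter κ) {u : DoubleTensor A}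
    (hu : counit A u = 0) (v : DoubleTensor A) : κ (u * v) = counit A v * κ u := by
  rw [h.map_mul, hu, zero_mul, zero_add]

theorem counit_ι (x : TPlus A) : counit A (TensorAlgebra.ι ℂ x) = 0 := by
  rw [counit_eq, TensorAlgebra.algebraMapInv, TensorAlgebra.lift_ι_apply]
  simp

theorem counit_subword {n : ℕ} (a : Fin n → A) {S : Finset (Fin n)} (hS : S.Nonempty) :
    counit A (subword a S) = 0 := by
  rw [subword, dif_pos (Finset.card_pos.mpr hS)]
  exact counit_ι _

theorem subword_empty {n : ℕ} (a : Fin n → A) : subword a ∅ = 1 := by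
  rw [subword, dif_neg (by simp)]

theorem subword_univ (n : ℕ+) (a : Fin (n : ℕ) → A) : subword a Finset.univ = word n a := by
  rw [subword]
  refine (apply_restrict_univ
    (fun k b => if h : 0 < k then word ⟨k, h⟩ b else (1 : DoubleTensor A)) a).trans ?_
  exact dif_pos n.pos

theorem barWord_cons {n : ℕ} (a : Fin n → A) (J : Finset (Fin n)) (L : List (Finset (Fin n))) :
    barWord a (J :: L) = subword a J * barWord a L := by
  simp [barWord]

theorem counit_barWord {n : ℕ} (a : Fin n → A) {U : Finset (Fin n)} (hU : U.Nonempty) :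
    counit A (barWord a (components U)) = 0 := by
  obtain ⟨i, hi⟩ := hU
  obtain ⟨J, hJ, -⟩ := exists_mem_components.mpr hi
  cases hL : components U with
  | nil => simp [hL] at hJ
  | cons J L =>
    rw [barWord_cons, counit_mul, counit_subword a (nonempty_of_mem_components
      (U := U) (hL ▸ List.mem_cons_self)), zero_mul]

theorem components_empty {n : ℕ} : components (∅ : Finset (Fin n)) = [] := by
  rw [List.eq_nil_iff_forall_not_mem]
  intro J hJ
  obtain ⟨x, hx⟩ := nonempty_of_mem_components hJ
  simpa using subset_of_mem_components hJ hx

theorem components_of_isInterval {n : ℕ} {U : Finset (Fin n)} (hU : U.Nonempty)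
    (h : IsInterval U) : components U = [U] := by
  have key : ∀ J ∈ components U, J = U := by
    intro J hJ
    obtain ⟨i, hi, rfl⟩ := mem_components.mp hJ
    refine (subset_of_mem_components hJ).antisymm fun j hj => mem_component.mpr fun k hk => ?_
    rcases hk with hk | hk
    · exact h i hi j hj k hk.1 hk.2
    · exact h j hj i hi k hk.1 hk.2
  have hn := nodup_components U
  obtain ⟨i, hi⟩ := hU
  obtain ⟨J, hJ, -⟩ := exists_mem_components.mpr hi
  match hL : components U with
  | [] => simp [hL] at hJ
  | [J] => rw [key J (by simp [hL])]
  | J :: J' :: L =>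
    have h1 := key J (by simp [hL])
    have h2 := key J' (by simp [hL])
    rw [hL, h1, h2] at hn
    simp at hn

theorem isInterval_univ {n : ℕ} : IsInterval (Finset.univ : Finset (Fin n)) :=
  fun _ _ _ _ j _ _ => Finset.mem_univ j

/-- A bar product of at least two nonempty words is killed by `β`, and a set with a single component
is an interval. -/
theorem IsInfinitesimalCharacter.map_barWord {β : DoubleTensor A →ₗ[ℂ] Grassmann}
    (h : IsInfinitesimalCharacter β) {n : ℕ} (a : Fin n → A) {U : Finset (Fin n)}
    (hU : U.Nonempty) [Decidable (IsInterval U)] :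
    β (barWord a (components U)) = if IsInterval U then β (subword a U) else 0 := by
  split_ifs with hI
  · rw [components_of_isInterval hU hI]
    simp [barWord]
  · obtain ⟨i, hi⟩ := hU
    obtain ⟨J, hJ, -⟩ := exists_mem_components.mpr hi
    have hne : ∀ J ∈ components U, counit A (subword a J) = 0 := fun J hJ =>
      counit_subword a (nonempty_of_mem_components hJ)
    match hL : components U with
    | [] => simp [hL] at hJ
    | [J] =>
      refine absurd ?_ hI
      have hJU : J = U := by
        refine (subset_of_mem_components (hL ▸ List.mem_cons_self)).antisymm fun x hx => ?_
        obtain ⟨J', hJ', hx⟩ := exists_mem_components.mpr hx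
        rw [hL, List.mem_singleton] at hJ'
        exact hJ' ▸ hx
      exact hJU ▸ IsInterval.of_mem_components (U := U) (hL ▸ List.mem_cons_self)
    | J :: J' :: L =>
      rw [barWord_cons, h.map_mul, barWord_cons, counit_mul, hne J (by simp [hL]),
        hne J' (by simp [hL])]
      simp

/-! ### Counitality -/

theorem cutSum_wordPlus (𝒮 : ∀ n : ℕ+, Finset (Finset (Fin (n : ℕ)))) (n : ℕ+)
    (a : Fin (n : ℕ) → A) : cutSum (A := A) 𝒮 (wordPlus (A := A) n a) =
      ∑ S ∈ 𝒮 n, subword a S ⊗ₜ[ℂ] barWord a (components Sᶜ) := by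
  simp only [cutSum, wordPlus, LinearMap.compMultilinearMap_apply, DirectSum.toModule_lof,
    PiTensorProduct.lift.tprod, sum_apply]
  rfl

theorem linearMap_ext_words {M : Type*} [AddCommGroup M] [Module ℂ M] {f g : TPlus A →ₗ[ℂ] M}
    (h : ∀ (n : ℕ+) (a : Fin (n : ℕ) → A), f (wordPlus (A := A) n a) = g (wordPlus (A := A) n a)) :
    f = g :=
  DirectSum.linearMap_ext _ fun n => PiTensorProduct.ext (MultilinearMap.ext fun a => h n a)

theorem coproduct_word (n : ℕ+) (a : Fin (n : ℕ) → A) : coproduct A (word n a) =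
    ∑ S : Finset (Fin (n : ℕ)), subword a S ⊗ₜ[ℂ] barWord a (components Sᶜ) := by
  rw [coproduct, word, LinearMap.compMultilinearMap_apply, TensorAlgebra.lift_ι_apply,
    cutSum_wordPlus]

/-- `ε̃` as a morphism of algebras. -/
noncomputable def counitHom (A : Type*) [Ring A] [Algebra ℂ A] : DoubleTensor A →ₐ[ℂ] Grassmann :=
  (Algebra.ofId ℂ Grassmann).comp TensorAlgebra.algebraMapInv

/-- For characters, the pairing is itself a morphism of algebras because 𝔾 is commutative, so
identities for it need checking only on words. -/
theorem pairing_algHom_apply (f g : DoubleTensor A →ₐ[ℂ] Grassmann)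
    (t : DoubleTensor A ⊗[ℂ] DoubleTensor A) :
    Algebra.TensorProduct.productMap f g t = pairing f.toLinearMap g.toLinearMap t := by
  induction t with
  | zero => simp
  | tmul u v => simp
  | add s t hs ht => rw [map_add, map_add, hs, ht]

theorem algHom_ext_words {B : Type*} [Ring B] [Algebra ℂ B] {f g : DoubleTensor A →ₐ[ℂ] B}
    (h : ∀ (n : ℕ+) (a : Fin (n : ℕ) → A), f (word n a) = g (word n a)) : f = g :=
  TensorAlgebra.hom_ext (linearMap_ext_words h)

/-- On a word the counit in the first factor leaves only `S = ∅`. In the mirror statement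
`pairing_coproduct_counit` only `S = univ` survives. -/
theorem pairing_counit_coproduct (Φ : DoubleTensor A →ₐ[ℂ] Grassmann) (w : DoubleTensor A) :
    pairing (counit A) Φ.toLinearMap (coproduct A w) = Φ w := by
  have : (Algebra.TensorProduct.productMap (counitHom A) Φ).comp (coproduct A) = Φ := by
    refine algHom_ext_words fun n a => ?_
    rw [AlgHom.comp_apply, pairing_algHom_apply, coproduct_word, map_sum,
      Finset.sum_eq_single ∅]
    · rw [pairing_tmul, subword_empty, Finset.compl_empty,
        components_of_isInterval ⟨⟨0, n.pos⟩, Finset.mem_univ _⟩ isInterval_univ]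
      simp [barWord, subword_univ]
    · intro S _ hS
      rw [pairing_tmul]
      have := counit_subword a (Finset.nonempty_iff_ne_empty.mpr hS)
      rw [show (counitHom A).toLinearMap = counit A from rfl, this, zero_mul]
    · simp
  exact (pairing_algHom_apply (counitHom A) Φ _).symm.trans (DFunLike.congr_fun this w)

theorem pairing_coproduct_counit (Φ : DoubleTensor A →ₐ[ℂ] Grassmann) (w : DoubleTensor A) :
    pairing Φ.toLinearMap (counit A) (coproduct A w) = Φ w := by
  have : (Algebra.TensorProduct.productMap Φ (counitHom A)).comp (coproduct A) = Φ := by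
    refine algHom_ext_words fun n a => ?_
    rw [AlgHom.comp_apply, pairing_algHom_apply, coproduct_word, map_sum,
      Finset.sum_eq_single Finset.univ]
    · rw [pairing_tmul, subword_univ, Finset.compl_univ, components_empty]
      simp [barWord]
    · intro S _ hS
      rw [pairing_tmul]
      have := counit_barWord a (U := Sᶜ) (by
        rwa [Finset.nonempty_iff_ne_empty, Ne, Finset.compl_eq_empty_iff])
      rw [show (counitHom A).toLinearMap = counit A from rfl, this, mul_zero]
    · simp
  exact (pairing_algHom_apply Φ (counitHom A) _).symm.trans (DFunLike.congr_fun this w)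

/-! ### The half-shuffle equations on words -/

/-- Since `u` has counit 0, the derivation rule lets `κ` see the first factor of `s` only through
the counit. Counitality then turns the second pairing on the right into a value of `Φ`. -/
theorem pairing_mul_left {κ : DoubleTensor A →ₗ[ℂ] Grassmann} (h : IsInfinitesimalCharacter κ)
    (Φ : DoubleTensor A →ₐ[ℂ] Grassmann) {u : DoubleTensor A} (hu : counit A u = 0)
    (v : DoubleTensor A) (s : DoubleTensor A ⊗[ℂ] DoubleTensor A) :
    pairing κ Φ.toLinearMap ((u ⊗ₜ v) * s) =
      pairing κ Φ.toLinearMap (u ⊗ₜ v) * pairing (counit A) Φ.toLinearMap s := by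
  induction s with
  | zero => simp
  | tmul s t =>
    rw [Algebra.TensorProduct.tmul_mul_tmul, pairing_tmul, pairing_tmul, pairing_tmul,
      h.map_mul_of_counit_eq_zero hu, AlgHom.toLinearMap_apply, AlgHom.toLinearMap_apply,
      AlgHom.toLinearMap_apply, map_mul]
    ring
  | add s t hs ht => rw [mul_add, map_add, map_add, hs, ht, mul_add]

theorem pairing_mul_right {β : DoubleTensor A →ₗ[ℂ] Grassmann} (h : IsInfinitesimalCharacter β)
    (Φ : DoubleTensor A →ₐ[ℂ] Grassmann) (u : DoubleTensor A) {v : DoubleTensor A}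
    (hv : counit A v = 0) (s : DoubleTensor A ⊗[ℂ] DoubleTensor A) :
    pairing Φ.toLinearMap β ((u ⊗ₜ v) * s) =
      pairing Φ.toLinearMap β (u ⊗ₜ v) * pairing Φ.toLinearMap (counit A) s := by
  induction s with
  | zero => simp
  | tmul s t =>
    rw [Algebra.TensorProduct.tmul_mul_tmul, pairing_tmul, pairing_tmul, pairing_tmul,
      h.map_mul_of_counit_eq_zero hv, AlgHom.toLinearMap_apply, AlgHom.toLinearMap_apply,
      AlgHom.toLinearMap_apply, map_mul]
    ring
  | add s t hs ht => rw [mul_add, map_add, map_add, hs, ht, mul_add]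

/-- The elements `1` and `ι x * w` span `H`. Since `f` and `g` are merely linear, the induction runs
on a left factor `u`, for all `w` at which they already agree. -/
theorem linearMap_ext_of_ι_mul {M : Type*} [AddCommGroup M] [Module ℂ M]
    {f g : DoubleTensor A →ₗ[ℂ] M} (h1 : f 1 = g 1)
    (h : ∀ x w, f (TensorAlgebra.ι ℂ x * w) = g (TensorAlgebra.ι ℂ x * w)) : f = g := by
  have key : ∀ u w : DoubleTensor A, f w = g w → f (u * w) = g (u * w) := by
    intro u
    induction u using TensorAlgebra.induction with
    | algebraMap r =>
      intro w hw
      rw [Algebra.algebraMap_eq_smul_one, smul_one_mul, map_smul, map_smul, hw]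
    | ι x => exact fun w _ => h x w
    | mul u v hu hv =>
      intro w hw
      rw [mul_assoc]
      exact hu _ (hv _ hw)
    | add u v hu hv =>
      intro w hw
      rw [add_mul, map_add, map_add, hu w hw, hv w hw]
  ext w
  simpa using key w 1 h1

theorem IsInfinitesimalCharacter.ext {κ κ' : DoubleTensor A →ₗ[ℂ] Grassmann}
    (h : IsInfinitesimalCharacter κ) (h' : IsInfinitesimalCharacter κ')
    (hw : ∀ (n : ℕ+) (a : Fin (n : ℕ) → A), κ (word (A := A) n a) = κ' (word n a)) : κ = κ' := by
  have hι : κ.comp (TensorAlgebra.ι ℂ) = κ'.comp (TensorAlgebra.ι ℂ) := linearMap_ext_words hw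
  refine linearMap_ext_of_ι_mul (h.1.trans h'.1.symm) fun x w => ?_
  rw [h.map_mul_of_counit_eq_zero (counit_ι x), h'.map_mul_of_counit_eq_zero (counit_ι x)]
  exact congrArg _ (DFunLike.congr_fun hι x)

/-- With a second nilpotent δ, independent of ħ, multiplicativity of `F = ε̃ + δ κ` is exactly the
derivation rule for `κ`. Freeness of the tensor algebra supplies `F` from its values `δ k` on `T_+`.
-/
theorem exists_isInfinitesimalCharacter (k : TPlus A →ₗ[ℂ] Grassmann) :
    ∃ κ : DoubleTensor A →ₗ[ℂ] Grassmann, IsInfinitesimalCharacter κ ∧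
      ∀ x, κ (TensorAlgebra.ι ℂ x) = k x := by
  let F : DoubleTensor A →ₐ[ℂ] DualNumber Grassmann :=
    TensorAlgebra.lift ℂ ((TrivSqZeroExt.inrHom Grassmann Grassmann).restrictScalars ℂ ∘ₗ k)
  have hι : ∀ x, F (TensorAlgebra.ι ℂ x) = TrivSqZeroExt.inr (k x) := fun x =>
    TensorAlgebra.lift_ι_apply _ _
  have key : ∀ w, (F w).fst = counit A w := by
    have : (TrivSqZeroExt.fstHom ℂ Grassmann Grassmann).comp F = counitHom A := by
      refine TensorAlgebra.hom_ext (LinearMap.ext fun x => ?_)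
      change (F (TensorAlgebra.ι ℂ x)).fst = counit A (TensorAlgebra.ι ℂ x)
      rw [hι, counit_ι, TrivSqZeroExt.fst_inr]
    exact fun w => DFunLike.congr_fun this w
  refine ⟨(TrivSqZeroExt.sndHom Grassmann Grassmann).restrictScalars ℂ ∘ₗ F.toLinearMap,
    ⟨?_, fun u v hu hv => ?_⟩, fun x => ?_⟩
  · change (F 1).snd = 0
    rw [map_one, TrivSqZeroExt.snd_one]
  · change (F (u * v)).snd = 0
    rw [map_mul, TrivSqZeroExt.snd_mul, key, key, counit_eq, counit_eq, hu, hv]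
    simp
  · change (F (TensorAlgebra.ι ℂ x)).snd = k x
    rw [hι, TrivSqZeroExt.snd_inr]

/-- At `ι x * w` both sides are their values at `ι x` times `Φ w`, so only words matter. -/
theorem eq_counit_add_halfPrec_iff {κ : DoubleTensor A →ₗ[ℂ] Grassmann}
    (h : IsInfinitesimalCharacter κ) (Φ : DoubleTensor A →ₐ[ℂ] Grassmann) :
    Φ.toLinearMap = counit A + halfPrec κ Φ.toLinearMap ↔
      ∀ (n : ℕ+) (a : Fin (n : ℕ) → A), Φ (word n a) =
        ∑ S ∈ Finset.univ.filter fun S : Finset (Fin (n : ℕ)) => ⟨0, n.pos⟩ ∈ S,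
          κ (subword a S) * Φ (barWord a (components Sᶜ)) := by
  have h1 : ∀ (x : TPlus A) (s : DoubleTensor A ⊗[ℂ] DoubleTensor A),
      pairing κ Φ.toLinearMap (leftHalf A x * s) =
        pairing κ Φ.toLinearMap (leftHalf A x) * pairing (counit A) Φ.toLinearMap s := by
    intro x s
    have : (pairing κ Φ.toLinearMap ∘ₗ LinearMap.mulRight ℂ s) ∘ₗ leftHalf A =
        (LinearMap.mulRight ℂ (pairing (counit A) Φ.toLinearMap s) ∘ₗ
          pairing κ Φ.toLinearMap) ∘ₗ leftHalf A := by
      refine linearMap_ext_words fun n a => ?_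
      simp only [LinearMap.comp_apply, LinearMap.mulRight_apply, leftHalf, cutSum_wordPlus,
        map_sum]
      refine Finset.sum_congr rfl fun S hS => pairing_mul_left h Φ (counit_subword a ?_) _ s
      exact ⟨_, (Finset.mem_filter.mp hS).2⟩
    exact DFunLike.congr_fun this x
  have h2 : ∀ x w, halfPrec κ Φ.toLinearMap (TensorAlgebra.ι ℂ x * w) =
      pairing κ Φ.toLinearMap (leftHalf A x) * Φ w := by
    intro x w
    change pairing κ Φ.toLinearMap (extend (leftHalf A) (TensorAlgebra.ι ℂ x * w)) = _
    rw [extend_mul, h1, pairing_counit_coproduct]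
  have h3 : ∀ (n : ℕ+) (a : Fin (n : ℕ) → A), pairing κ Φ.toLinearMap
      (leftHalf A (wordPlus (A := A) n a)) =
        ∑ S ∈ Finset.univ.filter fun S : Finset (Fin (n : ℕ)) => ⟨0, n.pos⟩ ∈ S,
          κ (subword a S) * Φ (barWord a (components Sᶜ)) := by
    intro n a
    simp only [leftHalf, cutSum_wordPlus, map_sum, pairing_tmul, AlgHom.toLinearMap_apply]
  constructor
  · intro he n a
    -- The factor `1` puts the word into the form `ι x * w` required by `h2`.
    have := DFunLike.congr_fun he (TensorAlgebra.ι ℂ (wordPlus (A := A) n a) * 1)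
    rw [LinearMap.add_apply, h2, h3, mul_one, counit_ι, map_one, mul_one, zero_add] at this
    exact this
  · intro he
    have hx : Φ.toLinearMap ∘ₗ TensorAlgebra.ι ℂ = pairing κ Φ.toLinearMap ∘ₗ leftHalf A :=
      linearMap_ext_words fun n a => (he n a).trans (h3 n a).symm
    refine linearMap_ext_of_ι_mul ?_ fun x w => ?_
    · have : halfPrec κ Φ.toLinearMap 1 = 0 := by
        change pairing κ Φ.toLinearMap (extend (leftHalf A) 1) = 0
        rw [extend_one, map_zero]
      rw [LinearMap.add_apply, this, counit_one, AlgHom.toLinearMap_apply, map_one, add_zero]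
    · rw [LinearMap.add_apply, h2, counit_mul, counit_ι, zero_mul, zero_add,
        AlgHom.toLinearMap_apply, map_mul]
      exact congrArg (· * Φ w) (DFunLike.congr_fun hx x)

open Classical in
theorem eq_counit_add_halfSucc_iff {β : DoubleTensor A →ₗ[ℂ] Grassmann}
    (h : IsInfinitesimalCharacter β) (Φ : DoubleTensor A →ₐ[ℂ] Grassmann) :
    Φ.toLinearMap = counit A + halfSucc Φ.toLinearMap β ↔
      ∀ (n : ℕ+) (a : Fin (n : ℕ) → A), Φ (word n a) =
        ∑ S ∈ Finset.univ.filter fun S : Finset (Fin (n : ℕ)) => ⟨0, n.pos⟩ ∈ S,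
          β (subword a S) * if IsInterval S then Φ (subword a Sᶜ) else 0 := by
  have h1 : ∀ (x : TPlus A) (s : DoubleTensor A ⊗[ℂ] DoubleTensor A),
      pairing Φ.toLinearMap β (rightHalf A x * s) =
        pairing Φ.toLinearMap β (rightHalf A x) * pairing Φ.toLinearMap (counit A) s := by
    intro x s
    have : (pairing Φ.toLinearMap β ∘ₗ LinearMap.mulRight ℂ s) ∘ₗ rightHalf A =
        (LinearMap.mulRight ℂ (pairing Φ.toLinearMap (counit A) s) ∘ₗ
          pairing Φ.toLinearMap β) ∘ₗ rightHalf A := by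
      refine linearMap_ext_words fun n a => ?_
      simp only [LinearMap.comp_apply, LinearMap.mulRight_apply, rightHalf, cutSum_wordPlus,
        map_sum]
      refine Finset.sum_congr rfl fun S hS => pairing_mul_right h Φ _ (counit_barWord a ?_) s
      exact ⟨_, Finset.mem_compl.mpr (Finset.mem_filter.mp hS).2⟩
    exact DFunLike.congr_fun this x
  have h2 : ∀ x w, halfSucc Φ.toLinearMap β (TensorAlgebra.ι ℂ x * w) =
      pairing Φ.toLinearMap β (rightHalf A x) * Φ w := by
    intro x w
    change pairing Φ.toLinearMap β (extend (rightHalf A) (TensorAlgebra.ι ℂ x * w)) = _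
    rw [extend_mul, h1, pairing_coproduct_counit]
  have h3 : ∀ (n : ℕ+) (a : Fin (n : ℕ) → A), pairing Φ.toLinearMap β
      (rightHalf A (wordPlus (A := A) n a)) =
        ∑ S ∈ Finset.univ.filter fun S : Finset (Fin (n : ℕ)) => ⟨0, n.pos⟩ ∈ S,
          β (subword a S) * if IsInterval S then Φ (subword a Sᶜ) else 0 := by
    intro n a
    simp only [rightHalf, cutSum_wordPlus, map_sum, pairing_tmul, AlgHom.toLinearMap_apply]
    -- In `Δ_≻` the first letter lies outside `S`, on the side of `β`; passing to complements makes
    -- `S` the argument of `β`.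
    refine Finset.sum_bij (fun S _ => Sᶜ) ?_ ?_ ?_ ?_
    · exact fun S hS => Finset.mem_filter.mpr
        ⟨Finset.mem_univ _, Finset.mem_compl.mpr (Finset.mem_filter.mp hS).2⟩
    · intro S _ T _ hST
      exact compl_injective hST
    · exact fun S hS => ⟨Sᶜ, Finset.mem_filter.mpr ⟨Finset.mem_univ _, fun h =>
        Finset.mem_compl.mp h (Finset.mem_filter.mp hS).2⟩, compl_compl S⟩
    · intro S hS
      rw [h.map_barWord a ⟨_, Finset.mem_compl.mpr (Finset.mem_filter.mp hS).2⟩, compl_compl]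
      split_ifs
      · exact mul_comm _ _
      · rw [mul_zero, mul_zero]
  constructor
  · intro he n a
    have := DFunLike.congr_fun he (TensorAlgebra.ι ℂ (wordPlus (A := A) n a) * 1)
    rw [LinearMap.add_apply, h2, h3, mul_one, counit_ι, map_one, mul_one, zero_add] at this
    exact this
  · intro he
    have hx : Φ.toLinearMap ∘ₗ TensorAlgebra.ι ℂ = pairing Φ.toLinearMap β ∘ₗ rightHalf A :=
      linearMap_ext_words fun n a => (he n a).trans (h3 n a).symm
    refine linearMap_ext_of_ι_mul ?_ fun x w => ?_
    · have : halfSucc Φ.toLinearMap β 1 = 0 := by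
        change pairing Φ.toLinearMap β (extend (rightHalf A) 1) = 0
        rw [extend_one, map_zero]
      rw [LinearMap.add_apply, this, counit_one, AlgHom.toLinearMap_apply, map_one, add_zero]
    · rw [LinearMap.add_apply, h2, counit_mul, counit_ι, zero_mul, zero_add,
        AlgHom.toLinearMap_apply, map_mul]
      exact congrArg (· * Φ w) (DFunLike.congr_fun hx x)

end Characters

/-! ### Cumulants with values in the Grassmann algebra -/

section DualCumulants

/-- This is the product rule: since ħ² = 0, each surviving ħ-term takes `g` from exactly one factor.
It is the source of the shape of `blockDeriv`. -/
theorem dualNumber_prod {ι : Type*} [DecidableEq ι] (s : Finset ι) (f g : ι → ℂ) :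
    ∏ i ∈ s, (TrivSqZeroExt.inl (f i) + TrivSqZeroExt.inr (g i) : Grassmann) =
      TrivSqZeroExt.inl (∏ i ∈ s, f i) +
        TrivSqZeroExt.inr (∑ i ∈ s, g i * ∏ j ∈ s.erase i, f j) := by
  induction s using Finset.induction_on with
  | empty => simp
  | insert a s ha ih =>
    have h : ∑ i ∈ s, g i * ∏ j ∈ (insert a s).erase i, f j =
        f a * ∑ i ∈ s, g i * ∏ j ∈ s.erase i, f j := by
      rw [Finset.mul_sum]
      refine Finset.sum_congr rfl fun i hi => ?_
      have hne : a ≠ i := fun h => ha (h ▸ hi)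
      rw [Finset.erase_insert_of_ne hne,
        Finset.prod_insert (fun h => ha (Finset.mem_of_mem_erase h))]
      ring
    rw [Finset.prod_insert ha, ih, Finset.prod_insert ha, Finset.sum_insert ha, h,
      Finset.erase_insert ha]
    ext
    · simp
    · simp
      ring

variable {A : Type*}

/-- The cumulants of `m + ħ m'`, assembled from the cumulants and the infinitesimal cumulants. -/
noncomputable def dualCumulant
    (P : ∀ n : ℕ, Finset (Finpartition (Finset.univ : Finset (Fin n))))
    (m m' : ∀ n : ℕ, (Fin n → A) → ℂ) (n : ℕ) (a : Fin n → A) : Grassmann :=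
  TrivSqZeroExt.inl (cumulant P m n a) + TrivSqZeroExt.inr (infCumulant P m m' n a)

/-- The function `V ↦ g_{|V|}(a_V)`. -/
def onBlocks {R : Type*} (g : ∀ n : ℕ, (Fin n → A) → R) {n : ℕ} (a : Fin n → A)
    (V : Finset (Fin n)) : R :=
  g V.card (restrict a V)

variable [Ring A] [Algebra ℂ A]

theorem tildeFunctional_eq_sum (φ φ' : A →ₗ[ℂ] ℂ)
    (P : ∀ n : ℕ, Finset (Finpartition (Finset.univ : Finset (Fin n)))) {n : ℕ}
    {τ : Finpartition (Finset.univ : Finset (Fin n))} (hτ : τ.parts = {Finset.univ})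
    (hP : τ ∈ P n) (a : Fin n → A) :
    tildeFunctional φ φ' (List.ofFn a).prod =
      ∑ π ∈ P n, ∏ V ∈ π.parts, onBlocks (dualCumulant P (moment φ) (moment φ')) a V := by
  have h1 := sum_blockProd_cumulant P (moment φ) hτ hP a
  have h2 := sum_blockDeriv_infCumulant P (moment φ) (moment φ') hτ hP a
  simp only [onBlocks, dualCumulant, dualNumber_prod]
  have hl := fun f : Finpartition (Finset.univ : Finset (Fin n)) → ℂ =>
    (map_sum (TrivSqZeroExt.inlHom ℂ ℂ) f (P n)).symm
  have hr := fun f : Finpartition (Finset.univ : Finset (Fin n)) → ℂ =>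
    (map_sum (TrivSqZeroExt.inrHom ℂ ℂ) f (P n)).symm
  rw [Finset.sum_add_distrib]
  refine Eq.trans ?_ (congrArg₂ (· + ·) (hl _) (hr _)).symm
  change _ = TrivSqZeroExt.inl (∑ π ∈ P n, blockProd (cumulant P (moment φ)) π a) +
    TrivSqZeroExt.inr (∑ π ∈ P n,
      blockDeriv (cumulant P (moment φ)) (infCumulant P (moment φ) (moment φ')) π a)
  rw [← h1, ← h2]
  ext <;> simp [tildeFunctional, moment]

end DualCumulants

/-! ### Partition sums for relations given on every `Fin n`, and multilinearity -/

section PartitionFamily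

variable {A R : Type*} [CommRing R] {r : ∀ n : ℕ, Finset (Fin n) → Finset (Fin n) → Prop}

theorem partitionSum_empty {α : Type*} [Fintype α] (r : Finset α → Finset α → Prop)
    (f : Finset α → R) : partitionSum r f ∅ = 1 := by
  have : partitionsAvoiding r ∅ = {∅} := by
    ext P
    rw [mem_partitionsAvoiding, Finset.mem_singleton]
    constructor
    · rintro ⟨h, -⟩
      refine Finset.eq_empty_of_forall_notMem fun V hV => ?_
      obtain ⟨x, hx⟩ := h.nonempty V hV
      simpa using h.subset V hV hx
    · rintro rfl
      exact ⟨⟨by simp, by simp, by simp, by simp⟩, fun V hV => by simp at hV⟩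
  rw [partitionSum, this]
  simp

/-- Relabelling `J` increasingly turns a partition sum over `J` into a full partition sum for the
tuple `a_J`, that is, into a moment of `a_J`. -/
theorem partitionSum_restrict
    (hr : ∀ {m n : ℕ} (e : Fin m ↪o Fin n) (V W : Finset (Fin m)),
      r n (V.map e.toEmbedding) (W.map e.toEmbedding) ↔ r m V W)
    (g : ∀ n : ℕ, (Fin n → A) → R) {n : ℕ} (a : Fin n → A) (J : Finset (Fin n)) :
    partitionSum (r n) (onBlocks g a) J =
      partitionSum (r J.card) (onBlocks g (restrict a J)) Finset.univ := by
  have h := partitionSum_map (J.orderEmbOfFin rfl).toEmbedding (hr (J.orderEmbOfFin rfl))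
    (onBlocks g a) Finset.univ
  have hJ : Finset.univ.map (J.orderEmbOfFin rfl).toEmbedding = J := by
    apply Finset.coe_injective
    simp
  rw [hJ] at h
  rw [h]
  congr 1
  funext V
  exact apply_restrict_map g (J.orderEmbOfFin rfl) a V

variable [Algebra ℂ R] [AddCommGroup A] [Module ℂ A]

theorem isLinearMap_sum {ι : Type*} (s : Finset ι) {f : ι → A → R}
    (h : ∀ i ∈ s, IsLinearMap ℂ (f i)) : IsLinearMap ℂ fun x => ∑ i ∈ s, f i x where
  map_add x y := by
    rw [← Finset.sum_add_distrib]
    exact Finset.sum_congr rfl fun i hi => (h i hi).map_add x y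
  map_smul c x := by
    rw [Finset.smul_sum]
    exact Finset.sum_congr rfl fun i hi => (h i hi).map_smul c x

/-- The cumulants of multilinear moments are multilinear. -/
theorem isLinearMap_of_partitionSum (M : ∀ n : ℕ, MultilinearMap ℂ (fun _ : Fin n => A) R)
    {g : ∀ n : ℕ, (Fin n → A) → R}
    (hg : ∀ n (a : Fin n → A), M n a = partitionSum (r n) (onBlocks g a) Finset.univ) (n : ℕ) :
    ∀ (a : Fin n → A) (i : Fin n), IsLinearMap ℂ fun x => g n (Function.update a i x) := by
  classical
  induction n using Nat.strong_induction_on with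
  | _ n ih =>
  intro a i
  -- The one-block partition avoids every relation; `i` shows that its block is nonempty.
  have htop : {Finset.univ} ∈ partitionsAvoiding (r n) Finset.univ := by
    rw [mem_partitionsAvoiding]
    refine ⟨⟨?_, fun _ _ => Finset.subset_univ _, fun x _ => ⟨_, Finset.mem_singleton_self _,
      Finset.mem_univ x⟩, ?_⟩, ?_⟩
    · intro V hV
      rw [Finset.mem_singleton.mp hV]
      exact ⟨i, Finset.mem_univ i⟩
    · intro V hV W hW _ _ _
      exact (Finset.mem_singleton.mp hV).trans (Finset.mem_singleton.mp hW).symm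
    · intro V hV W hW _
      exact (Finset.mem_singleton.mp hV).trans (Finset.mem_singleton.mp hW).symm
  have hrec : ∀ b : Fin n → A, g n b = M n b -
      ∑ P ∈ (partitionsAvoiding (r n) Finset.univ).erase {Finset.univ},
        ∏ V ∈ P, onBlocks g b V := by
    intro b
    rw [hg, partitionSum, ← Finset.add_sum_erase _ _ htop, Finset.prod_singleton, onBlocks,
      apply_restrict_univ g b, add_sub_cancel_right]
  have hlin : IsLinearMap ℂ fun x =>
      ∑ P ∈ (partitionsAvoiding (r n) Finset.univ).erase {Finset.univ},
        ∏ V ∈ P, onBlocks g (Function.update a i x) V := by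
    refine isLinearMap_sum _ fun P hP => ?_
    rw [Finset.mem_erase, mem_partitionsAvoiding] at hP
    obtain ⟨hne, hP, -⟩ := hP
    -- Only the factor of the block containing `i` depends on `x`. That block is proper, so the
    -- induction hypothesis makes the factor linear.
    obtain ⟨V, hV, hi⟩ := hP.cover i (Finset.mem_univ i)
    have hVcard : V.card < n := by
      have : V ≠ Finset.univ := by
        rintro rfl
        refine hne (Finset.eq_singleton_iff_unique_mem.mpr ⟨hV, fun W hW => ?_⟩)
        obtain ⟨x, hx⟩ := hP.nonempty W hW
        exact hP.eq_of_mem W hW _ hV x hx (Finset.mem_univ x)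
      simpa using Finset.card_lt_card (Finset.ssubset_univ_iff.mpr this)
    obtain ⟨k, hk⟩ := restrict_update_of_mem a hi
    have hL := ih V.card hVcard (restrict a V) k
    have heq : ∀ x, ∏ W ∈ P, onBlocks g (Function.update a i x) W =
        g V.card (Function.update (restrict a V) k x) * ∏ W ∈ P.erase V, onBlocks g a W := by
      intro x
      rw [← Finset.mul_prod_erase P _ hV, onBlocks, hk]
      congr 1
      refine Finset.prod_congr rfl fun W hW => ?_
      rw [onBlocks, restrict_update_of_notMem, onBlocks]
      intro hiW
      exact Finset.ne_of_mem_erase hW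
        (hP.eq_of_mem W (Finset.mem_of_mem_erase hW) V hV i hiW hi)
    simp only [heq]
    exact ⟨fun x y => by rw [hL.map_add, add_mul],
      fun c x => by rw [hL.map_smul, smul_mul_assoc]⟩
  simp only [hrec]
  exact ⟨fun x y => by rw [hlin.map_add, (M n).map_update_add]; abel,
    fun c x => by rw [hlin.map_smul, (M n).map_update_smul, smul_sub]⟩

end PartitionFamily

/-! ### Existence and uniqueness -/

section Solutions

variable {A : Type*} [Ring A] [Algebra ℂ A]

theorem subword_of_nonempty {n : ℕ} (a : Fin n → A) {S : Finset (Fin n)} (hS : S.Nonempty) :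
    ∃ (m : ℕ+) (b : Fin (m : ℕ) → A), (m : ℕ) = S.card ∧ subword a S = word m b :=
  ⟨⟨S.card, Finset.card_pos.mpr hS⟩, restrict a S, rfl, dif_pos (Finset.card_pos.mpr hS)⟩

theorem apply_subword {X : Type*} {f : DoubleTensor A → X} {g : ∀ n : ℕ, (Fin n → A) → X}
    (h : ∀ (n : ℕ+) (a : Fin (n : ℕ) → A), f (word n a) = g n a) {n : ℕ} (a : Fin n → A)
    {S : Finset (Fin n)} (hS : S.Nonempty) : f (subword a S) = onBlocks g a S := by
  rw [subword, dif_pos (Finset.card_pos.mpr hS)]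
  exact h ⟨S.card, Finset.card_pos.mpr hS⟩ (restrict a S)

theorem exists_isInfinitesimalCharacter_word {g : ∀ n : ℕ, (Fin n → A) → Grassmann}
    (hg : ∀ n (a : Fin n → A) (i : Fin n), IsLinearMap ℂ fun x => g n (Function.update a i x)) :
    ∃ κ : DoubleTensor A →ₗ[ℂ] Grassmann, IsInfinitesimalCharacter κ ∧
      ∀ (n : ℕ+) (a : Fin (n : ℕ) → A), κ (word n a) = g n a := by
  let G : ∀ n : ℕ, MultilinearMap ℂ (fun _ : Fin n => A) Grassmann := fun n =>
    { toFun := g n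
      map_update_add' := fun {inst} a i x y => by
        rw [Subsingleton.elim inst (instDecidableEqFin n)]
        exact (hg n a i).map_add x y
      map_update_smul' := fun {inst} a i c x => by
        rw [Subsingleton.elim inst (instDecidableEqFin n)]
        exact (hg n a i).map_smul c x }
  obtain ⟨κ, h, hκ⟩ := exists_isInfinitesimalCharacter
    (DirectSum.toModule ℂ ℕ+ _ fun n : ℕ+ => PiTensorProduct.lift (G n) : TPlus A →ₗ[ℂ] Grassmann)
  refine ⟨κ, h, fun n a => ?_⟩
  rw [word, LinearMap.compMultilinearMap_apply, hκ, wordPlus, LinearMap.compMultilinearMap_apply,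
    DirectSum.toModule_lof, PiTensorProduct.lift.tprod]
  rfl

/-- A triangular system on words has at most one solution. -/
theorem eq_on_words_of_triangular {κ κ' : DoubleTensor A →ₗ[ℂ] Grassmann}
    (c : ∀ n : ℕ+, (Fin (n : ℕ) → A) → Finset (Fin (n : ℕ)) → Grassmann)
    (hc : ∀ n a, c n a Finset.univ = 1)
    (h : ∀ (n : ℕ+) (a : Fin (n : ℕ) → A),
      ∑ S ∈ Finset.univ.filter fun S : Finset (Fin (n : ℕ)) => ⟨0, n.pos⟩ ∈ S,
        κ (subword a S) * c n a S =
      ∑ S ∈ Finset.univ.filter fun S : Finset (Fin (n : ℕ)) => ⟨0, n.pos⟩ ∈ S,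
        κ' (subword a S) * c n a S) (n : ℕ+) :
    ∀ a : Fin (n : ℕ) → A, κ (word n a) = κ' (word n a) := by
  induction n using PNat.strongInductionOn with
  | _ n ih =>
  intro a
  -- The summand of `univ` is the value at the word itself; every other `S` yields a strictly
  -- shorter nonempty word.
  have hu : Finset.univ ∈ Finset.univ.filter fun S : Finset (Fin (n : ℕ)) => ⟨0, n.pos⟩ ∈ S :=
    Finset.mem_filter.mpr ⟨Finset.mem_univ _, Finset.mem_univ _⟩
  have := h n a
  rw [← Finset.add_sum_erase _ _ hu, ← Finset.add_sum_erase _ _ hu, hc, mul_one, mul_one,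
    subword_univ] at this
  refine add_right_cancel (this.trans (congrArg _ (Finset.sum_congr rfl fun S hS => ?_)))
  rw [Finset.mem_erase, Finset.mem_filter] at hS
  have hne : S.Nonempty := ⟨_, hS.2.2⟩
  obtain ⟨m, b, hm, hb⟩ := subword_of_nonempty a hne
  rw [hb, ih m]
  rw [← PNat.coe_lt_coe, hm]
  simpa using Finset.card_lt_card (Finset.ssubset_univ_iff.mpr hS.1)

variable (φ φ' : A →ₗ[ℂ] ℂ)

theorem tildeCharacter_word_eq (n : ℕ+) (a : Fin (n : ℕ) → A) :
    tildeCharacter φ φ' (word n a) = tildeFunctional φ φ' (List.ofFn a).prod := by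
  rw [tildeCharacter, word, LinearMap.compMultilinearMap_apply, TensorAlgebra.lift_ι_apply,
    onWords_wordPlus]

variable {φ φ'}

theorem tildeFunctional_one (hφ : φ 1 = 1) (hφ' : φ' 1 = 0) : tildeFunctional φ φ' 1 = 1 := by
  simp [tildeFunctional, hφ, hφ']

theorem tildeCharacter_subword (hφ : φ 1 = 1) (hφ' : φ' 1 = 0) {n : ℕ} (a : Fin n → A)
    (S : Finset (Fin n)) :
    tildeCharacter φ φ' (subword a S) = tildeFunctional φ φ' (List.ofFn (restrict a S)).prod := by
  -- For `S = ∅` the subword is the unit of `H`, and the normalisations of `φ` and `φ'` make both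
  -- sides equal to 1.
  rcases S.eq_empty_or_nonempty with rfl | hS
  · rw [subword_empty, map_one]
    have : (List.ofFn (restrict a ∅)).prod = 1 := by
      rw [List.prod_eq_one]
      intro x hx
      rw [List.mem_ofFn] at hx
      obtain ⟨i, -⟩ := hx
      exact absurd i.2 (by simp)
    rw [this, tildeFunctional_one hφ hφ']
  · exact apply_subword (g := fun _ b => tildeFunctional φ φ' (List.ofFn b).prod)
      (tildeCharacter_word_eq φ φ') a hS

/-- The moment-cumulant formula with values in `𝔾`, for the partitions that avoid `r`. -/
theorem tildeFunctional_eq_partitionSum (hφ : φ 1 = 1) (hφ' : φ' 1 = 0)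
    {r : ∀ n : ℕ, Finset (Fin n) → Finset (Fin n) → Prop}
    {P : ∀ n : ℕ, Finset (Finpartition (Finset.univ : Finset (Fin n)))}
    (hP : ∀ n π, π ∈ P n ↔ Avoids (r n) π.parts)
    (hτ : ∀ n, 0 < n → ∃ τ : Finpartition (Finset.univ : Finset (Fin n)),
      τ.parts = {Finset.univ} ∧ τ ∈ P n) (n : ℕ) (a : Fin n → A) :
    tildeFunctional φ φ' (List.ofFn a).prod =
      partitionSum (r n) (onBlocks (dualCumulant P (moment φ) (moment φ')) a) Finset.univ := by
  -- The case `n = 0` lies outside the cumulant formulas: the empty set has one partition, with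
  -- product 1, matching the value at the unit.
  rcases n.eq_zero_or_pos with rfl | hn
  · rw [Finset.univ_eq_empty, partitionSum_empty, List.ofFn_zero, List.prod_nil,
      tildeFunctional_one hφ hφ']
  · obtain ⟨τ, h, hτP⟩ := hτ n hn
    rw [tildeFunctional_eq_sum φ φ' P h hτP, sum_finpartition (r n) (P n) (hP n)]

theorem tildeCharacter_subword_eq_partitionSum (hφ : φ 1 = 1) (hφ' : φ' 1 = 0)
    {r : ∀ n : ℕ, Finset (Fin n) → Finset (Fin n) → Prop}
    (hr : ∀ {m n : ℕ} (e : Fin m ↪o Fin n) (V W : Finset (Fin m)),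
      r n (V.map e.toEmbedding) (W.map e.toEmbedding) ↔ r m V W)
    {g : ∀ n : ℕ, (Fin n → A) → Grassmann}
    (hg : ∀ n (a : Fin n → A), tildeFunctional φ φ' (List.ofFn a).prod =
      partitionSum (r n) (onBlocks g a) Finset.univ) {n : ℕ} (a : Fin n → A)
    (J : Finset (Fin n)) :
    tildeCharacter φ φ' (subword a J) = partitionSum (r n) (onBlocks g a) J := by
  rw [tildeCharacter_subword hφ hφ', hg]
  exact (partitionSum_restrict hr g a J).symm

theorem exists_isInfinitesimalCharacter_cumulant
    {r : ∀ n : ℕ, Finset (Fin n) → Finset (Fin n) → Prop}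
    {g : ∀ n : ℕ, (Fin n → A) → Grassmann}
    (hg : ∀ n (a : Fin n → A), tildeFunctional φ φ' (List.ofFn a).prod =
      partitionSum (r n) (onBlocks g a) Finset.univ) :
    ∃ κ : DoubleTensor A →ₗ[ℂ] Grassmann, IsInfinitesimalCharacter κ ∧
      ∀ (n : ℕ+) (a : Fin (n : ℕ) → A), κ (word n a) = g n a :=
  exists_isInfinitesimalCharacter_word (isLinearMap_of_partitionSum (fun n =>
    (tildeFunctional φ φ').compMultilinearMap (MultilinearMap.mkPiAlgebraFin ℂ n A)) fun n a => by
      rw [LinearMap.compMultilinearMap_apply, MultilinearMap.mkPiAlgebraFin_apply, hg])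

/-- On words the equation is the recursion `partitionSum_crosses`, with each `Φ̃(a_J)` expanded as
the partition sum over the component `J`. -/
theorem exists_solution_halfPrec (hφ : φ 1 = 1) (hφ' : φ' 1 = 0) :
    ∃ κ : DoubleTensor A →ₗ[ℂ] Grassmann, (IsInfinitesimalCharacter κ ∧
      (tildeCharacter φ φ').toLinearMap =
        counit A + halfPrec κ (tildeCharacter φ φ').toLinearMap) ∧
      ∀ (n : ℕ+) (a : Fin (n : ℕ) → A),
        κ (word n a) = dualCumulant NC (moment φ) (moment φ') n a := by
  have hg := tildeFunctional_eq_partitionSum hφ hφ' (r := fun _ => Crosses) (P := NC)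
    (fun _ => mem_NC_iff) fun n hn => let ⟨τ, h, h1, _⟩ := exists_one_block hn; ⟨τ, h, h1⟩
  obtain ⟨κ, h, hκ⟩ := exists_isInfinitesimalCharacter_cumulant hg
  refine ⟨κ, ⟨h, (eq_counit_add_halfPrec_iff h _).mpr fun n a => ?_⟩, hκ⟩
  rw [tildeCharacter_word_eq, hg, partitionSum_crosses _ ⟨0, n.pos⟩ fun x => Nat.zero_le _]
  refine Finset.sum_congr rfl fun S hS => ?_
  rw [apply_subword hκ a ⟨_, (Finset.mem_filter.mp hS).2⟩, barWord, map_list_prod,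
    List.map_map]
  congr 3
  funext J
  exact (tildeCharacter_subword_eq_partitionSum hφ hφ' crosses_map hg a J).symm

theorem exists_solution_halfSucc (hφ : φ 1 = 1) (hφ' : φ' 1 = 0) :
    ∃ β : DoubleTensor A →ₗ[ℂ] Grassmann, (IsInfinitesimalCharacter β ∧
      (tildeCharacter φ φ').toLinearMap =
        counit A + halfSucc (tildeCharacter φ φ').toLinearMap β) ∧
      ∀ (n : ℕ+) (a : Fin (n : ℕ) → A),
        β (word n a) = dualCumulant IntervalPartitions (moment φ) (moment φ') n a := by
  have hg := tildeFunctional_eq_partitionSum hφ hφ' (r := fun _ => Interleaves)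
    (P := IntervalPartitions) (fun _ => mem_intervalPartitions_iff)
    fun n hn => let ⟨τ, h, _, h1⟩ := exists_one_block hn; ⟨τ, h, h1⟩
  obtain ⟨β, h, hβ⟩ := exists_isInfinitesimalCharacter_cumulant hg
  refine ⟨β, ⟨h, (eq_counit_add_halfSucc_iff h _).mpr fun n a => ?_⟩, hβ⟩
  rw [tildeCharacter_word_eq, hg, partitionSum_interleaves _ ⟨0, n.pos⟩ fun x => Nat.zero_le _]
  refine Finset.sum_congr rfl fun S hS => ?_
  rw [apply_subword hβ a ⟨_, (Finset.mem_filter.mp hS).2⟩,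
    tildeCharacter_subword_eq_partitionSum hφ hφ' interleaves_map hg a]

/-- For fixed `Φ` the system is linear in `κ`, and the coefficient at `S = univ` is `Φ` of the empty
bar word, which is 1. -/
theorem halfPrec_solution_unique (Φ : DoubleTensor A →ₐ[ℂ] Grassmann)
    {κ κ' : DoubleTensor A →ₗ[ℂ] Grassmann} (h : IsInfinitesimalCharacter κ)
    (he : Φ.toLinearMap = counit A + halfPrec κ Φ.toLinearMap) (h' : IsInfinitesimalCharacter κ')
    (he' : Φ.toLinearMap = counit A + halfPrec κ' Φ.toLinearMap) : κ = κ' := by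
  rw [eq_counit_add_halfPrec_iff h] at he
  rw [eq_counit_add_halfPrec_iff h'] at he'
  refine h.ext h' (eq_on_words_of_triangular (fun n a S => Φ (barWord a (components Sᶜ))) ?_
    fun n a => (he n a).symm.trans (he' n a))
  intro n a
  simp [components_empty, barWord]

theorem halfSucc_solution_unique (Φ : DoubleTensor A →ₐ[ℂ] Grassmann)
    {β β' : DoubleTensor A →ₗ[ℂ] Grassmann} (h : IsInfinitesimalCharacter β)
    (he : Φ.toLinearMap = counit A + halfSucc Φ.toLinearMap β) (h' : IsInfinitesimalCharacter β')
    (he' : Φ.toLinearMap = counit A + halfSucc Φ.toLinearMap β') : β = β' := by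
  classical
  rw [eq_counit_add_halfSucc_iff h] at he
  rw [eq_counit_add_halfSucc_iff h'] at he'
  refine h.ext h' (eq_on_words_of_triangular
    (fun n a S => if IsInterval S then Φ (subword a Sᶜ) else 0) ?_
    fun n a => ?_)
  · intro n a
    simp [isInterval_univ, subword_empty]
  · have := (he n a).symm.trans (he' n a)
    convert this

end Solutions

end InfShuffle

/-! ### The main theorem -/

open InfShuffle
theorem mainTheorem3 {A : Type*} [Ring A] [Algebra ℂ A]
    (φ φ' : A →ₗ[ℂ] ℂ) (hφ : φ 1 = 1) (hφ' : φ' 1 = 0) :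
    (∃! κ : DoubleTensor A →ₗ[ℂ] Grassmann, IsInfinitesimalCharacter κ ∧
      (tildeCharacter φ φ').toLinearMap = counit A + halfPrec κ (tildeCharacter φ φ').toLinearMap) ∧
    (∃! β : DoubleTensor A →ₗ[ℂ] Grassmann, IsInfinitesimalCharacter β ∧
      (tildeCharacter φ φ').toLinearMap = counit A + halfSucc (tildeCharacter φ φ').toLinearMap β) ∧
    ∀ κ β : DoubleTensor A →ₗ[ℂ] Grassmann,
      IsInfinitesimalCharacter κ →
      (tildeCharacter φ φ').toLinearMap = counit A + halfPrec κ (tildeCharacter φ φ').toLinearMap →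
      IsInfinitesimalCharacter β →
      (tildeCharacter φ φ').toLinearMap = counit A + halfSucc (tildeCharacter φ φ').toLinearMap β →
      ∀ (n : ℕ+) (a : Fin (n : ℕ) → A),
        (κ (word n a)).snd = infFreeCumulant φ φ' n a ∧
        (β (word n a)).snd = infBooleanCumulant φ φ' n a := by
  obtain ⟨κ₀, hκ₀, hκw⟩ := exists_solution_halfPrec hφ hφ'
  obtain ⟨β₀, hβ₀, hβw⟩ := exists_solution_halfSucc hφ hφ'
  refine ⟨⟨κ₀, hκ₀, fun κ h => halfPrec_solution_unique _ h.1 h.2 hκ₀.1 hκ₀.2⟩,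
    ⟨β₀, hβ₀, fun β h => halfSucc_solution_unique _ h.1 h.2 hβ₀.1 hβ₀.2⟩, ?_⟩
  intro κ β hκ heκ hβ heβ n a
  -- By uniqueness, arbitrary solutions are the constructed ones, and the ħ-coefficient of
  -- `dualCumulant` is the infinitesimal cumulant.
  rw [halfPrec_solution_unique _ hκ heκ hκ₀.1 hκ₀.2, halfSucc_solution_unique _ hβ heβ hβ₀.1 hβ₀.2,
    hκw, hβw]
  simp [dualCumulant, infFreeCumulant, infBooleanCumulant]
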